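/- Let $n=2^k$ and $L=2^m$ ($k,m\ge 0$), let $V=\{v_i : i\in\{0,1\}^k\}$ be a set of $n$ vertices, $u\in V$, and $\Sigma=\{0\}\cup\{(1,i)\}\cup\{(2,j)\}$ with $i,j\in\{0,1\}^k$. **The network.** The undirected (arbitrarily oriented) multigraph $\mathcal N_{2^\ell}(u)$ has a source $[u]$, $n$ sinks $[u,v_i]$, and edge set $\Sigma^\ell\times\{0,1\}^k$. $\mathcal N_1(u)$ is the star whose edge $i$ goes from $[u]$ to $[u,v_i]$ and has query label $(u,v_i)$. $\mathcal N_{2^{\ell+1}}(u)$ consists of $2n+1$ copies of $\mathcal N_{2^{\ell}}$ labelled by $\Sigma$: copy $0$ is $\mathcal N_{2^\ell}(u)$, copy $(1,i)$ is $\mathcal N_{2^\ell}(v_i)$, and copy $(2,j)$ is $\mathcal N_{2^\ell}(u)$ with all edges reversed. For all $i,j$, the $i$-th sink of copy $0$ is glued to the source of copy $(1,i)$, and the $j$-th sink of copy $(1,i)$ is glued to the $i$-th sink of copy $(2,j)$. The source of $\mathcal N_{2^{\ell+1}}(u)$ is that of copy $0$, and its $j$-th sink is the source of copy $(2,j)$.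 Edge $(\tau,i)$ of copy $a$ becomes edge $(a\tau,i)$. $\mathcal N_{2^\ell}(u,v_j)$ denotes this network with source $\mathsf s=[u]$ and single sink $\mathsf t=[u,v_j]$. **The space $\mathcal B$.** For a network with edge set $E$, source $\mathsf s$ and sink $\mathsf t$, let $H$ be the (real or complex) inner product space with orthonormal basis $|{\to},e\rangle,|{\leftarrow},e\rangle$ ($e\in E$), $|\mathsf s\rangle,|\mathsf t\rangle,|{\leftarrow},\mathsf s\rangle,|{\to},\mathsf t\rangle$. $\mathcal B\subseteq H$ is the span of the vectors $|{\to},e\rangle+|{\leftarrow},e\rangle$ ($e\in E$), of $|{\leftarrow},\mathsf s\rangle+|{\to},\mathsf t\rangle$, and, for every vertex $w$, of $\sum_{e\text{ out of }w}|{\to},e\rangle+\sum_{e\text{ into }w}|{\leftarrow},e\rangle$, with $|{\leftarrow},\mathsf s\rangle$ added if $w=\mathsf s$ and $|{\to},\mathsf t\rangle$ added if $w=\mathsf t$. **Flows.** For $\theta:E\to\mathbb R$ put $\theta(w)=\sum_{e\text{ out of }w}\theta(e)-\sum_{e\text{ into }w}\theta(e)$, $|\bar\theta\rangle=\sum_{e}\theta(e)\,|e\rangle$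 where $|e\rangle=|{\to},e\rangle-|{\leftarrow},e\rangle$, and $|\theta\rangle=-\theta(\mathsf s)|{\leftarrow},\mathsf s\rangle+|\bar\theta\rangle-\theta(\mathsf t)|{\to},\mathsf t\rangle$. A unit $\mathsf s\mathsf t$-flow satisfies $\theta(\mathsf s)=1=-\theta(\mathsf t)$ and $\theta(w)=0$ for all other $w$; it is optimal if it minimizes $\sum_e\theta(e)^2$ among the unit $\mathsf s\mathsf t$-flows. **Theorem.** For all $\ell\ge0$ and $i\in\{0,1\}^k$ there is a unique optimal unit flow $\theta_i(2^\ell)$ from $[u]$ to $[u,v_i]$ in $\mathcal N_{2^\ell}(u)$. For $\ell\ge1$ and $i,j,x,z\in\{0,1\}^k$ let $$|p_{ij}(2^\ell)\rangle=|0\rangle|\bar\theta_i(2^{\ell-1})\rangle+|1,i\rangle|\bar\theta_j(2^{\ell-1})\rangle+|2,j\rangle|\bar\theta_i(2^{\ell-1})\rangle,$$ $$|\psi_{z,x}(2^\ell)\rangle=\sum_{j}(-1)^{x\cdot j}\sum_{i}(-1)^{z\cdot i}|p_{ij}(2^\ell)\rangle .$$ (Here, for a word $\sigma$ over $\Sigma$,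 $|\sigma\rangle|\psi\rangle$ is obtained from a combination $|\psi\rangle$ of the $|e\rangle$ by replacing each $|\tau,i\rangle$ by $|\sigma\tau,i\rangle$.) Then, for every $j\in\{0,1\}^k$, the vectors $$\bigcup_{\ell=1}^{m}\bigcup_{\sigma\in\Sigma^{m-\ell}}\big\{|\sigma\rangle|\psi_{z,x}(2^\ell)\rangle : z,x\in\{0,1\}^k,\ z\ne\bar0\big\}\ \cup\ \big\{|\theta_j(L)\rangle,\ |[u]\rangle,\ |[u,v_j]\rangle\big\}$$ form an orthogonal basis of $\mathcal B^\perp$, where $\mathcal B$ is the space of $\mathcal N_L(u,v_j)$, and $|[u]\rangle=|\mathsf s\rangle$, $|[u,v_j]\rangle=|\mathsf t\rangle$ (distinct indices give distinct nonzero vectors). -/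

import Mathlib

namespace SwitchNet

/-! ### Switching networks, their spaces, and flows -/

/-- A switching network with a source and a sink: vertex labels `V`, edge labels `E`
(a multigraph), each edge `e` oriented from `tail e` to a different vertex `head e`,
and each edge carrying a query label in `Q`.
So `e ∈ E^→(w)` iff `tail e = w`, and `e ∈ E^←(w)` iff `head e = w`. -/
structure SwitchingNetwork (V E Q : Type*) where
  tail : E → V
  head : E → V
  tail_ne_head : ∀ e, tail e ≠ head e
  source : V
  sink : V
  source_ne_sink : source ≠ sink
  query : E → Q

/-- Labels of the standard orthonormal basis of `H_N`:
`|→,e⟩`, `|←,e⟩` for each edge `e`, and `|s⟩`, `|t⟩`, `|←,s⟩`, `|→,t⟩`. -/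
inductive Label (E : Type*) where
  | right (e : E)
  | left (e : E)
  | src
  | snk
  | leftSrc
  | rightSnk
  deriving DecidableEq, Fintype

/-- The space `H_N` of a network with edge set `E`. -/
abbrev Space (𝕜 E : Type*) [RCLike 𝕜] [Fintype E] := EuclideanSpace 𝕜 (Label E)

section general

variable {V E Q : Type*} [Fintype E]

open Classical in
/-- The standard basis vector with the given label. -/
noncomputable def ket (𝕜 : Type*) [RCLike 𝕜] (a : Label E) : Space 𝕜 E :=
  EuclideanSpace.single a 1

open Classical in
/-- The vector `|ψ_⋆(w)⟩`, with the additional term `|←,s⟩` for `w = s` and `|→,t⟩` for `w = t`. -/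
noncomputable def SwitchingNetwork.star (𝕜 : Type*) [RCLike 𝕜]
    (N : SwitchingNetwork V E Q) (w : V) : Space 𝕜 E :=
  (∑ e with N.tail e = w, ket 𝕜 (Label.right e)) + (∑ e with N.head e = w, ket 𝕜 (Label.left e))
    + (if w = N.source then ket 𝕜 Label.leftSrc else 0)
    + (if w = N.sink then ket 𝕜 Label.rightSnk else 0)

/-- The space `B` of a switching network: the sum of the spaces spanned by the vectors `|ψ_⋆(w)⟩`,
by the vectors `|→,e⟩ + |←,e⟩`, and by `|←,s⟩ + |→,t⟩`. -/
noncomputable def SwitchingNetwork.spaceB (𝕜 : Type*) [RCLike 𝕜]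
    (N : SwitchingNetwork V E Q) : Submodule 𝕜 (Space 𝕜 E) :=
  Submodule.span 𝕜 (Set.range (N.star 𝕜))
    ⊔ Submodule.span 𝕜 (Set.range fun e : E => ket 𝕜 (Label.right e) + ket 𝕜 (Label.left e))
    ⊔ Submodule.span 𝕜 {ket 𝕜 (Label.leftSrc : Label E) + ket 𝕜 Label.rightSnk}

open Classical in
/-- The net flow `θ(w)` out of the vertex `w`. -/
noncomputable def SwitchingNetwork.netFlow (N : SwitchingNetwork V E Q) (θ : E → ℝ) (w : V) : ℝ :=
  (∑ e with N.tail e = w, θ e) - ∑ e with N.head e = w, θ e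

/-- A unit flow from the source to the sink. -/
def SwitchingNetwork.IsUnitFlow (N : SwitchingNetwork V E Q) (θ : E → ℝ) : Prop :=
  (∀ w, w ≠ N.source → w ≠ N.sink → N.netFlow θ w = 0) ∧
    N.netFlow θ N.source = 1 ∧ N.netFlow θ N.sink = -1

/-- An optimal unit flow: one of least energy `∑ e, θ(e)²` among the unit flows. -/
def SwitchingNetwork.IsOptimalUnitFlow (N : SwitchingNetwork V E Q) (θ : E → ℝ) : Prop :=
  N.IsUnitFlow θ ∧ ∀ θ' : E → ℝ, N.IsUnitFlow θ' → ∑ e, θ e ^ 2 ≤ ∑ e, θ' e ^ 2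

/-- The vector `∑ e, θ(e) |e⟩`, where `|e⟩ = |→,e⟩ - |←,e⟩`, of a real function `θ` on edges. -/
noncomputable def edgeState (𝕜 : Type*) [RCLike 𝕜] (θ : E → ℝ) : Space 𝕜 E :=
  ∑ e, (θ e : 𝕜) • (ket 𝕜 (Label.right e) - ket 𝕜 (Label.left e))

/-- The flow state `|θ⟩ = -θ(s)|←,s⟩ + ∑ e, θ(e)|e⟩ - θ(t)|→,t⟩`. -/
noncomputable def SwitchingNetwork.flowState (𝕜 : Type*) [RCLike 𝕜]
    (N : SwitchingNetwork V E Q) (θ : E → ℝ) : Space 𝕜 E :=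
  -((N.netFlow θ N.source : ℝ) : 𝕜) • ket 𝕜 Label.leftSrc + edgeState 𝕜 θ
    - ((N.netFlow θ N.sink : ℝ) : 𝕜) • ket 𝕜 Label.rightSnk

end general

/-- The family `b` is an orthogonal basis of the subspace `W`
(linear independence makes its members nonzero and distinct). -/
def IsOrthogonalBasis {𝕜 H ι : Type*} [RCLike 𝕜] [NormedAddCommGroup H] [InnerProductSpace 𝕜 H]
    (b : ι → H) (W : Submodule 𝕜 H) : Prop :=
  (∀ p q, p ≠ q → inner 𝕜 (b p) (b q) = 0) ∧ LinearIndependent 𝕜 b ∧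
    Submodule.span 𝕜 (Set.range b) = W

/-! ### The recursive network `N_{2^ℓ}(u)` -/

/-- Bit strings of length `k = log n`; they index the `n = 2^k` vertices of the input digraph. -/
abbrev Bits (k : ℕ) := Fin k → ZMod 2

/-- The alphabet `Σ = {(0,0̄)} ∪ {(1,i)} ∪ {(2,j)}`. -/
inductive Sym (k : ℕ) where
  | zero
  | one (i : Bits k)
  | two (j : Bits k)
  deriving DecidableEq, Fintype

/-- Edge labels of `N_{2^ℓ}`: the set `Σ^ℓ × {0,1}^k`. -/
abbrev Edge (k ℓ : ℕ) := (Fin ℓ → Sym k) × Bits k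

/-- Vertices of `N_{2^ℓ}` other than the source and the `n` sinks. For `ℓ + 1` these are:
* `inl i`: the `i`-th sink of copy `0`, glued with the source of copy `(1,i)`;
* `inr (inl (i, j))`: the `j`-th sink of copy `(1,i)`, glued with the `i`-th sink of copy `(2,j)`;
* `inr (inr (a, w))`: the interior vertex `w` of copy `a`. -/
def Interior (k : ℕ) : ℕ → Type
  | 0 => Empty
  | ℓ + 1 => Bits k ⊕ (Bits k × Bits k) ⊕ (Sym k × Interior k ℓ)

/-- Vertices of `N_{2^ℓ}(u)`: the source `[u]`, the sinks `[u,v_j]`, and the interior vertices. -/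
inductive Vertex (k ℓ : ℕ) where
  | source
  | sink (j : Bits k)
  | interior (w : Interior k ℓ)

/-- The vertex of `N_{2^(ℓ+1)}` that a vertex of the copy of `N_{2^ℓ}` with the given symbol becomes. -/
def place {k ℓ : ℕ} : Sym k → Vertex k ℓ → Vertex k (ℓ + 1)
  | .zero, .source => .source
  | .zero, .sink i => .interior (Sum.inl i)
  | .one i, .source => .interior (Sum.inl i)
  | .one i, .sink j => .interior (Sum.inr (Sum.inl (i, j)))
  | .two j, .source => .sink j
  | .two j, .sink i => .interior (Sum.inr (Sum.inl (i, j)))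
  | a, .interior w => .interior (Sum.inr (Sum.inr (a, w)))

/-- The pairs of vertices of the `2n+1` copies that are glued together. -/
inductive Glued {k ℓ : ℕ} : Sym k × Vertex k ℓ → Sym k × Vertex k ℓ → Prop
  | first (i : Bits k) : Glued (.zero, .sink i) (.one i, .source)
  | second (i j : Bits k) : Glued (.one i, .sink j) (.two j, .sink i)

/-- Every vertex of `N_{2^(ℓ+1)}` comes from one of the copies ... -/
theorem place_surjective {k ℓ : ℕ} (w : Vertex k (ℓ + 1)) :
    ∃ p : Sym k × Vertex k ℓ, place p.1 p.2 = w := by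
  rcases w with _ | j | (i | ⟨i, j⟩ | ⟨a, w⟩)
  · exact ⟨(.zero, .source), rfl⟩
  · exact ⟨(.two j, .source), rfl⟩
  · exact ⟨(.zero, .sink i), rfl⟩
  · exact ⟨(.one i, .sink j), rfl⟩
  · exact ⟨(a, .interior w), by cases a <;> rfl⟩

/-- ... and two vertices of the copies are identified exactly when the gluing identifies them. -/
theorem place_eq_iff {k ℓ : ℕ} (p q : Sym k × Vertex k ℓ) :
    place p.1 p.2 = place q.1 q.2 ↔ Relation.EqvGen Glued p q := by
  constructor
  · intro h
    rcases p with ⟨_ | i | j, _ | s | w⟩ <;> rcases q with ⟨_ | i' | j', _ | s' | w'⟩ <;>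
      cases h <;>
      first
        | exact .refl _
        | exact .rel _ _ (.first _)
        | exact .symm _ _ (.rel _ _ (.first _))
        | exact .rel _ _ (.second _ _)
        | exact .symm _ _ (.rel _ _ (.second _ _))
  · intro h
    induction h with
    | rel _ _ h => cases h <;> rfl
    | refl => rfl
    | symm _ _ _ ih => exact ih.symm
    | trans _ _ _ _ _ ih₁ ih₂ => exact ih₁.trans ih₂

theorem place_injective {k ℓ : ℕ} (a : Sym k) :
    Function.Injective (place a : Vertex k ℓ → Vertex k (ℓ + 1)) := by
  intro w w' h
  rcases a with _ | i | j <;> rcases w with _ | s | w <;> rcases w' with _ | s' | w' <;>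
    cases h <;> rfl

/-- The pair (tail, head) of an edge of `N_{2^ℓ}`. The base case is the star with `n` edges
from the source to the sinks; the orientation is reversed in the copies `(2,j)`. -/
def ends {k : ℕ} : (ℓ : ℕ) → Edge k ℓ → Vertex k ℓ × Vertex k ℓ
  | 0, e => (.source, .sink e.2)
  | ℓ + 1, e =>
    let p := ends ℓ (Fin.tail e.1, e.2)
    match e.1 0 with
    | .zero => (place .zero p.1, place .zero p.2)
    | .one i => (place (.one i) p.1, place (.one i) p.2)
    | .two j => (place (.two j) p.2, place (.two j) p.1)

theorem ends_ne {k : ℕ} : ∀ (ℓ : ℕ) (e : Edge k ℓ), (ends ℓ e).1 ≠ (ends ℓ e).2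
  | 0, e => by simp [ends]
  | ℓ + 1, e => by
    have ih := ends_ne ℓ (Fin.tail e.1, e.2)
    rw [ends]
    cases e.1 0 with
    | zero => exact fun h => ih (place_injective _ h)
    | one i => exact fun h => ih (place_injective _ h)
    | two j => exact fun h => ih (place_injective _ h).symm

/-- The query label of an edge of `N_{2^ℓ}(u)`. Copy `(1,i)` has root `v_i`; the copies `0` and
`(2,j)` have root `u`; the `i`-th edge of `N_1(u)` has label `(u, v_i)`. -/
def queryLabel {k : ℕ} {V : Type*} (v : Bits k ≃ V) : (ℓ : ℕ) → V → Edge k ℓ → V × V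
  | 0, u, e => (u, v e.2)
  | ℓ + 1, u, e =>
    match e.1 0 with
    | .zero => queryLabel v ℓ u (Fin.tail e.1, e.2)
    | .one i => queryLabel v ℓ (v i) (Fin.tail e.1, e.2)
    | .two _ => queryLabel v ℓ u (Fin.tail e.1, e.2)

/-- The switching network `N_{2^ℓ}(u, v_j)`, with source `[u]` and sink `[u,v_j]`. -/
def net {k : ℕ} {V : Type*} (v : Bits k ≃ V) (ℓ : ℕ) (u : V) (j : Bits k) :
    SwitchingNetwork (Vertex k ℓ) (Edge k ℓ) (V × V) where
  tail e := (ends ℓ e).1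
  head e := (ends ℓ e).2
  tail_ne_head := ends_ne ℓ
  source := .source
  sink := .sink j
  source_ne_sink := by simp
  query := queryLabel v ℓ u

/-! ### The vectors of the basis -/

/-- `|σ⟩|ψ⟩` for a word `σ ∈ Σ^d` and a function `ψ` on the edges of `N_{2^ℓ}`,
as a function on the edges of `N_{2^m}`, where `m = d + ℓ`. -/
def prepend {k d ℓ m : ℕ} (h : d + ℓ = m) (σ : Fin d → Sym k) (ψ : Edge k ℓ → ℝ) :
    Edge k m → ℝ := fun e =>
  if (fun a : Fin d => e.1 (Fin.cast h (Fin.castAdd ℓ a))) = σ then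
    ψ (fun b : Fin ℓ => e.1 (Fin.cast h (Fin.natAdd d b)), e.2)
  else 0

/-- `|a⟩|ψ⟩` for a single symbol `a ∈ Σ`. -/
def prependSym {k ℓ : ℕ} (a : Sym k) (ψ : Edge k ℓ → ℝ) : Edge k (ℓ + 1) → ℝ :=
  prepend (Nat.add_comm 1 ℓ) (fun _ : Fin 1 => a) ψ

/-- `p_ij(2^(ℓ+1)) = |0⟩|θ_i(2^ℓ)⟩ + |1,i⟩|θ_j(2^ℓ)⟩ + |2,j⟩|θ_i(2^ℓ)⟩`. -/
def pState {k ℓ : ℕ} (θ : Bits k → Edge k ℓ → ℝ) (i j : Bits k) : Edge k (ℓ + 1) → ℝ :=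
  prependSym .zero (θ i) + prependSym (.one i) (θ j) + prependSym (.two j) (θ i)

/-- The sign `(-1)^(x·y)`. -/
def sign {k : ℕ} (x y : Bits k) : ℝ := (-1) ^ (∑ a, (x a).val * (y a).val)

/-- `ψ_{z,x}(2^(ℓ+1)) = ∑_j (-1)^(x·j) ∑_i (-1)^(z·i) p_ij(2^(ℓ+1))`. -/
noncomputable def psiState {k ℓ : ℕ} (θ : Bits k → Edge k ℓ → ℝ) (z x : Bits k) :
    Edge k (ℓ + 1) → ℝ :=
  ∑ j, sign x j • ∑ i, sign z i • pState θ i j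

/-- Indices of the vectors of the basis for `N_{2^m}`: `circ` has a level `ℓ + 1 ∈ {1,…,m}`, a word
`σ ∈ Σ^d` of length `d = m - (ℓ + 1)`, and bit strings `z ≠ 0̄` and `x`. -/
inductive BasisIndex (k m : ℕ) where
  | circ (ℓ d : ℕ) (h : d + (ℓ + 1) = m) (σ : Fin d → Sym k) (z x : Bits k) (hz : z ≠ 0)
  | flow
  | src
  | snk

/-- The vectors `|σ⟩|ψ_{z,x}(2^(ℓ+1))⟩`, `|θ_j(2^m)⟩`, `|[u]⟩`, `|[u,v_j]⟩` in the space of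
`N_{2^m}(u, v_j)`, where `θ ℓ i` is a flow on `N_{2^ℓ}(u)` to the `i`-th sink. -/
noncomputable def basisVector (𝕜 : Type*) [RCLike 𝕜] {k : ℕ} {V : Type*} (v : Bits k ≃ V) (m : ℕ)
    (u : V) (j : Bits k) (θ : (ℓ : ℕ) → Bits k → Edge k ℓ → ℝ) :
    BasisIndex k m → Space 𝕜 (Edge k m)
  | .circ ℓ _ h σ z x _ => edgeState 𝕜 (prepend h σ (psiState (θ ℓ) z x))
  | .flow => (net v m u j).flowState 𝕜 (θ m j)
  | .src => ket 𝕜 Label.src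
  | .snk => ket 𝕜 Label.snk

end SwitchNet

namespace SwitchNet

/-! ### Flows with prescribed values at the sinks -/

/-! A vector of `spaceB`ᗮ is antisymmetric in the two directions of each edge and satisfies
conservation at every vertex, with the boundary coordinates counted in. Apart from the free
coordinates `src` and `snk` it is therefore a flow from source to sink, and after subtracting a
multiple of the unit flow it is a circulation. It remains to find an orthogonal basis of the
circulations and to see that the optimal flow is orthogonal to them.

Spanning (`mem_span_of_isFlow_zero`): a flow on the network of level `ℓ + 1` restricts to flows on
the copies, and gluing forces their boundary values into a single matrix `g`. Subtracting `∑ g i j •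
p_ij` leaves circulations inside the copies, which induction handles. For a circulation the columns
of `g` sum to zero, and the products of characters `sign z i * sign x j` with `z ≠ 0` span exactly
these matrices; they correspond to the states `psiState`.

Orthogonality: the Gram matrix of the flows `optFlow ℓ i` has the form `a I + b J`, with `J` the
all-ones matrix (`exists_optFlow_dotProduct`). The characters diagonalise it, so signed sums of
flows for different characters are orthogonal. Every copy sees `psiState` as a multiple of one
signed sum, which gives orthogonality within a level. Across levels it follows from optimal flows
being orthogonal to circulations, and by Pythagoras the same fact makes `optFlow` the unique optimal
flow.

Flows are handled weakly, by pairing with all potentials, because a potential on the glued network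
simply pulls back to each copy along `place`. -/

/-- The pairing of a function on the edges with the coboundary of a potential. -/
def pairing {k ℓ : ℕ} (θ : Edge k ℓ → ℝ) (φ : Vertex k ℓ → ℝ) : ℝ :=
  ∑ e, θ e * (φ (ends ℓ e).1 - φ (ends ℓ e).2)

/-- `θ` is a flow out of the source that delivers the amount `f i` at the `i`-th sink. -/
def IsFlow {k ℓ : ℕ} (f : Bits k → ℝ) (θ : Edge k ℓ → ℝ) : Prop :=
  ∀ φ : Vertex k ℓ → ℝ, pairing θ φ = ∑ i, f i * (φ .source - φ (.sink i))

theorem IsFlow.add {k ℓ : ℕ} {f g : Bits k → ℝ} {θ η : Edge k ℓ → ℝ} (hθ : IsFlow f θ)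
    (hη : IsFlow g η) : IsFlow (f + g) (θ + η) := fun φ => by
  have h1 := hθ φ
  have h2 := hη φ
  simp only [pairing, Pi.add_apply, add_mul, Finset.sum_add_distrib] at *
  rw [h1, h2]

theorem IsFlow.smul {k ℓ : ℕ} {f : Bits k → ℝ} {θ : Edge k ℓ → ℝ} (c : ℝ) (hθ : IsFlow f θ) :
    IsFlow (c • f) (c • θ) := fun φ => by
  have h1 := hθ φ
  simp only [pairing, Pi.smul_apply, smul_eq_mul, mul_assoc, ← Finset.mul_sum] at *
  rw [h1]

theorem IsFlow.sub {k ℓ : ℕ} {f g : Bits k → ℝ} {θ η : Edge k ℓ → ℝ} (hθ : IsFlow f θ)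
    (hη : IsFlow g η) : IsFlow (f - g) (θ - η) := by
  have := hθ.add (hη.smul (-1))
  simpa [sub_eq_add_neg] using this

theorem IsFlow.zero {k ℓ : ℕ} : IsFlow (0 : Bits k → ℝ) (0 : Edge k ℓ → ℝ) := fun φ => by
  simp [pairing]

theorem IsFlow.sum {k ℓ : ℕ} {ι : Type*} (s : Finset ι) {f : ι → Bits k → ℝ}
    {θ : ι → Edge k ℓ → ℝ} (h : ∀ a ∈ s, IsFlow (f a) (θ a)) :
    IsFlow (∑ a ∈ s, f a) (∑ a ∈ s, θ a) := by
  classical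
  induction s using Finset.induction_on with
  | empty => simpa using IsFlow.zero
  | insert a s ha ih =>
    rw [Finset.sum_insert ha, Finset.sum_insert ha]
    exact (h a (by simp)).add (ih fun b hb => h b (by simp [hb]))

theorem IsFlow.unique {k ℓ : ℕ} {f g : Bits k → ℝ} {θ : Edge k ℓ → ℝ} (hf : IsFlow f θ)
    (hg : IsFlow g θ) : f = g := by
  classical
  funext j
  have h := (hf (Pi.single (.sink j) 1)).symm.trans (hg (Pi.single (.sink j) 1))
  simpa [Pi.single_apply] using h

/-! ### From net flow at vertices to the pairing with potentials. -/

instance finite_interior (k : ℕ) : ∀ ℓ : ℕ, Finite (Interior k ℓ)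
  | 0 => inferInstanceAs (Finite Empty)
  | ℓ + 1 =>
    have := finite_interior k ℓ
    inferInstanceAs (Finite (Bits k ⊕ (Bits k × Bits k) ⊕ (Sym k × Interior k ℓ)))

/-- The vertices as a disjoint union. -/
def vertexEquiv (k ℓ : ℕ) : Unit ⊕ Bits k ⊕ Interior k ℓ ≃ Vertex k ℓ where
  toFun
    | .inl _ => .source
    | .inr (.inl j) => .sink j
    | .inr (.inr w) => .interior w
  invFun
    | .source => .inl ()
    | .sink j => .inr (.inl j)
    | .interior w => .inr (.inr w)
  left_inv := by rintro (_ | _ | _) <;> rfl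
  right_inv := by rintro (_ | _ | _) <;> rfl

noncomputable instance fintype_interior (k ℓ : ℕ) : Fintype (Interior k ℓ) := Fintype.ofFinite _

noncomputable instance fintype_vertex (k ℓ : ℕ) : Fintype (Vertex k ℓ) :=
  Fintype.ofEquiv _ (vertexEquiv k ℓ)

theorem sum_vertex {k ℓ : ℕ} (f : Vertex k ℓ → ℝ) :
    ∑ w, f w = f .source + (∑ j, f (.sink j) + ∑ w, f (.interior w)) := by
  rw [← (vertexEquiv k ℓ).sum_comp, Fintype.sum_sum_type, Fintype.sum_sum_type]
  simp [vertexEquiv]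

open Classical in
theorem netFlow_net {k ℓ : ℕ} {V : Type*} (v : Bits k ≃ V) (u : V) (j : Bits k)
    (θ : Edge k ℓ → ℝ) (w : Vertex k ℓ) :
    (net v ℓ u j).netFlow θ w = pairing θ (Pi.single w 1) := by
  rw [SwitchingNetwork.netFlow, Finset.sum_filter, Finset.sum_filter]
  simp only [pairing, Pi.single_apply, mul_sub, Finset.sum_sub_distrib, mul_ite, mul_one, mul_zero]
  rfl

open Classical in
theorem pairing_eq_sum {k ℓ : ℕ} (θ : Edge k ℓ → ℝ) (φ : Vertex k ℓ → ℝ) :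
    pairing θ φ = ∑ w, φ w * pairing θ (Pi.single w 1) := by
  simp only [pairing, Finset.mul_sum]
  rw [Finset.sum_comm]
  refine Finset.sum_congr rfl fun e _ => ?_
  have h : ∀ x : Vertex k ℓ, φ x =
      ∑ w, φ w * (Pi.single w (1 : ℝ) : Vertex k ℓ → ℝ) x := fun x => by
    simp [Pi.single_apply]
  conv_lhs => rw [h (ends ℓ e).1, h (ends ℓ e).2, ← Finset.sum_sub_distrib, Finset.mul_sum]
  exact Finset.sum_congr rfl fun w _ => by ring

open Classical in
-- Pairing with the constant potential gives zero, so the net flow at the source is determined by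
-- the values at the sinks and needs no hypothesis.
theorem isFlow_of_interior {k ℓ : ℕ} {θ : Edge k ℓ → ℝ}
    (h : ∀ w, pairing θ (Pi.single (.interior w) 1) = 0) :
    IsFlow (fun i => -pairing θ (Pi.single (.sink i) 1)) θ := fun φ => by
  have h1 : pairing θ (fun _ => 1) = 0 := by simp [pairing]
  rw [pairing_eq_sum, sum_vertex] at h1 ⊢
  simp only [h, one_mul, mul_zero, Finset.sum_const_zero, add_zero] at h1 ⊢
  rw [eq_neg_of_add_eq_zero_left h1]
  simp only [mul_neg, Finset.mul_sum, ← Finset.sum_neg_distrib, ← Finset.sum_add_distrib]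
  exact Finset.sum_congr rfl fun i _ => by ring

theorem isUnitFlow_iff {k ℓ : ℕ} {V : Type*} (v : Bits k ≃ V) (u : V) (j : Bits k)
    (θ : Edge k ℓ → ℝ) :
    (net v ℓ u j).IsUnitFlow θ ↔ IsFlow (Pi.single j 1) θ := by
  classical
  simp only [SwitchingNetwork.IsUnitFlow, netFlow_net]
  constructor
  · rintro ⟨h0, -, ht⟩
    convert isFlow_of_interior (θ := θ) fun w => ?_ using 2 with i
    · by_cases hij : i = j
      · subst hij
        simp only [net] at ht
        convert (neg_eq_iff_eq_neg.mpr ht).symm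
        simp
      · have := h0 (.sink i) (by simp [net]) (by simp [net, hij])
        rw [Pi.single_eq_of_ne hij]
        convert (neg_eq_zero.mpr this).symm
    · convert h0 (.interior w) (by simp [net]) (by simp [net])
  · intro h
    refine ⟨fun w hs ht => ?_, ?_, ?_⟩
    · rw [h]
      simp only [net] at hs ht
      refine Finset.sum_eq_zero fun i _ => ?_
      by_cases hij : i = j
      · subst hij
        simp [Ne.symm hs, Ne.symm ht]
      · simp [hij]
    · rw [h]; simp [net, Pi.single_apply]
    · rw [h]; simp [net, Pi.single_apply]

/-! ### Restriction to the copies -/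

/-- The restriction to the copy with symbol `a`. -/
def restr {k ℓ : ℕ} (a : Sym k) (θ : Edge k (ℓ + 1) → ℝ) : Edge k ℓ → ℝ :=
  fun e => θ (Fin.cons a e.1, e.2)

theorem sum_sym {k : ℕ} (f : Sym k → ℝ) :
    ∑ a, f a = f .zero + (∑ i, f (.one i) + ∑ j, f (.two j)) := by
  let eqv : Unit ⊕ Bits k ⊕ Bits k ≃ Sym k :=
    { toFun := fun
        | .inl _ => .zero
        | .inr (.inl i) => .one i
        | .inr (.inr j) => .two j
      invFun := fun
        | .zero => .inl ()
        | .one i => .inr (.inl i)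
        | .two j => .inr (.inr j)
      left_inv := by rintro (_ | _ | _) <;> rfl
      right_inv := by rintro (_ | _ | _) <;> rfl }
  rw [← eqv.sum_comp, Fintype.sum_sum_type, Fintype.sum_sum_type]
  simp [eqv]

theorem sum_edge {k ℓ : ℕ} (f : Edge k (ℓ + 1) → ℝ) :
    ∑ e, f e = ∑ a, ∑ e : Edge k ℓ, f (Fin.cons a e.1, e.2) := by
  rw [Fintype.sum_prod_type, ← (Fin.consEquiv fun _ : Fin (ℓ + 1) => Sym k).sum_comp,
    Fintype.sum_prod_type]
  refine Finset.sum_congr rfl fun a _ => ?_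
  rw [Fintype.sum_prod_type]
  rfl

theorem ext_restr {k ℓ : ℕ} {θ η : Edge k (ℓ + 1) → ℝ} (h : ∀ a, restr a θ = restr a η) :
    θ = η := by
  funext e
  have := congrFun (h (e.1 0)) (Fin.tail e.1, e.2)
  simpa [restr] using this

/-- The restriction to a copy as a linear map. -/
def restrₗ {k ℓ : ℕ} (a : Sym k) : (Edge k (ℓ + 1) → ℝ) →ₗ[ℝ] Edge k ℓ → ℝ where
  toFun := restr a
  map_add' _ _ := rfl
  map_smul' _ _ := rfl

theorem restr_add {k ℓ : ℕ} (a : Sym k) (θ η : Edge k (ℓ + 1) → ℝ) :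
    restr a (θ + η) = restr a θ + restr a η := rfl

theorem restr_smul {k ℓ : ℕ} (a : Sym k) (c : ℝ) (θ : Edge k (ℓ + 1) → ℝ) :
    restr a (c • θ) = c • restr a θ := rfl

theorem restr_sum {k ℓ : ℕ} {ι : Type*} (a : Sym k) (s : Finset ι) (θ : ι → Edge k (ℓ + 1) → ℝ) :
    restr a (∑ b ∈ s, θ b) = ∑ b ∈ s, restr a (θ b) :=
  map_sum (restrₗ a) θ s

theorem restr_prependSym {k ℓ : ℕ} (a b : Sym k) (ψ : Edge k ℓ → ℝ) :
    restr a (prependSym b ψ) = if a = b then ψ else 0 := by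
  funext e
  have h1 : (fun x : Fin 1 => (Fin.cons a e.1 : Fin (ℓ + 1) → Sym k)
      (Fin.cast (Nat.add_comm 1 ℓ) (Fin.castAdd ℓ x))) = fun _ => a := by
    funext x
    have : Fin.cast (Nat.add_comm 1 ℓ) (Fin.castAdd ℓ x) = 0 := by
      ext; simp
    rw [this, Fin.cons_zero]
  have h2 : (fun x : Fin ℓ => (Fin.cons a e.1 : Fin (ℓ + 1) → Sym k)
      (Fin.cast (Nat.add_comm 1 ℓ) (Fin.natAdd 1 x))) = e.1 := by
    funext x
    have : Fin.cast (Nat.add_comm 1 ℓ) (Fin.natAdd 1 x) = x.succ := by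
      ext; simp
    rw [this, Fin.cons_succ]
  have h3 : ((fun _ : Fin 1 => a) = fun _ => b) ↔ a = b :=
    ⟨fun h => congrFun h 0, fun h => by rw [h]⟩
  simp only [restr, prependSym, prepend, h1, h2, h3]
  split_ifs <;> rfl

theorem restr_prepend {k d ℓ m : ℕ} (h : d + 1 + ℓ = m + 1) (h' : d + ℓ = m) (a : Sym k)
    (σ : Fin (d + 1) → Sym k) (ψ : Edge k ℓ → ℝ) :
    restr a (prepend h σ ψ) = if a = σ 0 then prepend h' (Fin.tail σ) ψ else 0 := by
  subst h'
  funext e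
  have h1 : (fun x : Fin (d + 1) => (Fin.cons a e.1 : Fin (d + ℓ + 1) → Sym k)
      (Fin.cast h (Fin.castAdd ℓ x))) = Fin.cons a fun x => e.1 (Fin.castAdd ℓ x) := by
    funext x
    refine Fin.cases ?_ (fun x => ?_) x
    · have : Fin.cast h (Fin.castAdd ℓ 0) = 0 := by ext; simp
      rw [this, Fin.cons_zero, Fin.cons_zero]
    · have : Fin.cast h (Fin.castAdd ℓ x.succ) = (Fin.castAdd ℓ x).succ := by ext; simp
      rw [this, Fin.cons_succ, Fin.cons_succ]
  have h2 : (fun x : Fin ℓ => (Fin.cons a e.1 : Fin (d + ℓ + 1) → Sym k)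
      (Fin.cast h (Fin.natAdd (d + 1) x))) = fun x => e.1 (Fin.natAdd d x) := by
    funext x
    have : Fin.cast h (Fin.natAdd (d + 1) x) = (Fin.natAdd d x).succ := by
      ext; simp; omega
    rw [this, Fin.cons_succ]
  have h3 : ((Fin.cons a fun x => e.1 (Fin.castAdd ℓ x) : Fin (d + 1) → Sym k) = σ) ↔
      a = σ 0 ∧ (fun x => e.1 (Fin.castAdd ℓ x)) = Fin.tail σ := by
    constructor
    · rintro rfl; simp
    · rintro ⟨rfl, hb⟩; rw [hb, Fin.cons_self_tail]
  simp only [restr, prepend, h1, h2, h3]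
  by_cases ha : a = σ 0
  · simp only [ha, true_and, if_true]
    rfl
  · simp [ha]

theorem prepend_zero {k ℓ : ℕ} (h : 0 + ℓ = ℓ) (σ : Fin 0 → Sym k) (ψ : Edge k ℓ → ℝ) :
    prepend h σ ψ = ψ := by
  funext e
  have h1 : ∀ x : Fin 0 → Sym k, x = σ := fun x => Subsingleton.elim _ _
  have h2 : (fun x : Fin ℓ => e.1 (Fin.cast h (Fin.natAdd 0 x))) = e.1 := by
    funext x
    have : Fin.cast h (Fin.natAdd 0 x) = x := by ext; simp
    rw [this]
  rw [prepend, h2, if_pos (h1 _)]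

/-- Peeling off one letter removes the index casts in `prepend`; later inductions use only this and
`restr_prependSym`. -/
theorem prepend_succ {k d ℓ m : ℕ} (h : d + 1 + ℓ = m + 1) (h' : d + ℓ = m)
    (σ : Fin (d + 1) → Sym k) (ψ : Edge k ℓ → ℝ) :
    prepend h σ ψ = prependSym (σ 0) (prepend h' (Fin.tail σ) ψ) :=
  ext_restr fun a => by rw [restr_prepend h h', restr_prependSym]

/-- `|a⟩|·⟩` as a linear map. -/
def prependSymₗ {k ℓ : ℕ} (a : Sym k) : (Edge k ℓ → ℝ) →ₗ[ℝ] Edge k (ℓ + 1) → ℝ where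
  toFun := prependSym a
  map_add' x y := ext_restr fun b => by
    simp only [restr_prependSym, restr_add]; split_ifs <;> simp
  map_smul' c x := ext_restr fun b => by
    simp only [restr_prependSym, restr_smul, RingHom.id_apply]; split_ifs <;> simp

/-- The minus sign comes from the reversed orientation of the copies `(2,j)`. -/
theorem pairing_succ {k ℓ : ℕ} (θ : Edge k (ℓ + 1) → ℝ) (φ : Vertex k (ℓ + 1) → ℝ) :
    pairing θ φ = pairing (restr .zero θ) (φ ∘ place .zero) +
      (∑ i, pairing (restr (.one i) θ) (φ ∘ place (.one i)) -
        ∑ j, pairing (restr (.two j) θ) (φ ∘ place (.two j))) := by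
  rw [pairing, sum_edge, sum_sym, sub_eq_add_neg, ← Finset.sum_neg_distrib]
  congr 1
  congr 1
  refine Finset.sum_congr rfl fun j _ => ?_
  rw [pairing, ← Finset.sum_neg_distrib]
  refine Finset.sum_congr rfl fun e _ => ?_
  simp only [ends, Fin.cons_zero, Fin.tail_cons, restr, Function.comp]
  ring

/-! ### Gluing flows on the copies at the joints. -/

/-- The vertex where the `i`-th sink of copy `0` and the source of copy `(1,i)` are glued. -/
def firstJoint {k ℓ : ℕ} (i : Bits k) : Vertex k (ℓ + 1) := place .zero (.sink i)

/-- The vertex where the `j`-th sink of copy `(1,i)` and the `i`-th sink of copy `(2,j)` are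
glued. -/
def secondJoint {k ℓ : ℕ} (i j : Bits k) : Vertex k (ℓ + 1) := place (.one i) (.sink j)

theorem firstJoint_inj {k ℓ : ℕ} {i i' : Bits k} :
    (firstJoint i : Vertex k (ℓ + 1)) = firstJoint i' ↔ i = i' :=
  ⟨fun h => by cases h; rfl, fun h => h ▸ rfl⟩

theorem secondJoint_inj {k ℓ : ℕ} {i i' j j' : Bits k} :
    (secondJoint i j : Vertex k (ℓ + 1)) = secondJoint i' j' ↔ i = i' ∧ j = j' :=
  ⟨fun h => by cases h; exact ⟨rfl, rfl⟩, fun h => by rw [h.1, h.2]⟩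

theorem firstJoint_ne_secondJoint {k ℓ : ℕ} (i i' j : Bits k) :
    (firstJoint i : Vertex k (ℓ + 1)) ≠ secondJoint i' j := nofun

theorem source_ne_firstJoint {k ℓ : ℕ} (i : Bits k) :
    (Vertex.source : Vertex k (ℓ + 1)) ≠ firstJoint i := nofun

theorem source_ne_secondJoint {k ℓ : ℕ} (i j : Bits k) :
    (Vertex.source : Vertex k (ℓ + 1)) ≠ secondJoint i j := nofun

theorem sink_ne_firstJoint {k ℓ : ℕ} (i j : Bits k) :
    (Vertex.sink j : Vertex k (ℓ + 1)) ≠ firstJoint i := nofun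

theorem sink_ne_secondJoint {k ℓ : ℕ} (i j j' : Bits k) :
    (Vertex.sink j' : Vertex k (ℓ + 1)) ≠ secondJoint i j := nofun

theorem pairing_succ_of_isFlow {k ℓ : ℕ} {θ : Edge k (ℓ + 1) → ℝ} {f : Bits k → ℝ}
    {g h : Bits k → Bits k → ℝ} (h0 : IsFlow f (restr .zero θ))
    (h1 : ∀ i, IsFlow (g i) (restr (.one i) θ)) (h2 : ∀ j, IsFlow (h j) (restr (.two j) θ))
    (φ : Vertex k (ℓ + 1) → ℝ) :
    pairing θ φ = ∑ i, f i * (φ .source - φ (firstJoint i)) +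
      (∑ i, ∑ j, g i j * (φ (firstJoint i) - φ (secondJoint i j)) -
        ∑ j, ∑ i, h j i * (φ (.sink j) - φ (secondJoint i j))) := by
  rw [pairing_succ, h0]
  congr 1
  exact congrArg₂ _ (Finset.sum_congr rfl fun i _ => h1 i _)
    (Finset.sum_congr rfl fun j _ => h2 j _)

/-- Flows on the copies that agree at the glued vertices form a flow. -/
theorem isFlow_succ {k ℓ : ℕ} {θ : Edge k (ℓ + 1) → ℝ} {g : Bits k → Bits k → ℝ}
    (h0 : IsFlow (fun i => ∑ j, g i j) (restr .zero θ))
    (h1 : ∀ i, IsFlow (g i) (restr (.one i) θ))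
    (h2 : ∀ j, IsFlow (fun i => g i j) (restr (.two j) θ)) :
    IsFlow (fun j => ∑ i, g i j) θ := fun φ => by
  rw [pairing_succ_of_isFlow h0 h1 h2, Finset.sum_comm (f := fun j i => g i j * _),
    ← Finset.sum_sub_distrib, ← Finset.sum_add_distrib]
  simp only [Finset.sum_mul]
  rw [Finset.sum_comm (f := fun j i => g i j * _)]
  refine Finset.sum_congr rfl fun i _ => ?_
  rw [← Finset.sum_sub_distrib, ← Finset.sum_add_distrib]
  -- For each pair `(i, j)` the potential differences telescope along source, first joint, second
  -- joint, `j`-th sink.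
  exact Finset.sum_congr rfl fun j _ => by ring

/-- A flow restricts to flows on the copies that agree at the glued vertices. -/
theorem IsFlow.restr {k ℓ : ℕ} {θ : Edge k (ℓ + 1) → ℝ} {f : Bits k → ℝ} (hθ : IsFlow f θ) :
    ∃ g : Bits k → Bits k → ℝ, IsFlow (fun i => ∑ j, g i j) (restr .zero θ) ∧
      (∀ i, IsFlow (g i) (SwitchNet.restr (.one i) θ)) ∧
      (∀ j, IsFlow (fun i => g i j) (SwitchNet.restr (.two j) θ)) ∧
      f = fun j => ∑ i, g i j := by
  classical
  -- Interior vertices of a copy are glued to nothing, so conservation there is inherited from `θ`,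
  -- and this alone makes the restriction a flow.
  have key : ∀ a, ∃ f, IsFlow f (SwitchNet.restr a θ) := by
    intro a
    refine ⟨_, isFlow_of_interior fun w => ?_⟩
    have hp : ∀ (b : Sym k) (y : Vertex k ℓ), place b y = place a (.interior w) →
        b = a ∧ y = .interior w := by
      intro b y h
      rcases a with _ | a | a <;> rcases b with _ | b | b <;> rcases y with _ | y | y <;> cases h <;>
        exact ⟨rfl, rfl⟩
    have hw := hθ (Pi.single (place a (.interior w)) 1)
    have comp_eq : (Pi.single (place a (.interior w)) 1 : Vertex k (ℓ + 1) → ℝ) ∘ place a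
          = Pi.single (.interior w) 1 := by
      funext y
      rw [Function.comp, Pi.single_apply, Pi.single_apply]
      simp only [(place_injective a).eq_iff]
    have hz : ∀ b, b ≠ a → pairing (SwitchNet.restr b θ)
        ((Pi.single (place a (.interior w)) 1 : Vertex k (ℓ + 1) → ℝ) ∘ place b) = 0 := by
      intro b hb
      refine Finset.sum_eq_zero fun e _ => ?_
      simp only [Function.comp]
      rw [Pi.single_eq_of_ne fun h => hb (hp _ _ h).1, Pi.single_eq_of_ne fun h => hb (hp _ _ h).1,
        sub_zero, mul_zero]
    have hs : ∑ i, f i * ((Pi.single (place a (.interior w)) 1 : Vertex k (ℓ + 1) → ℝ) .source -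
        (Pi.single (place a (.interior w)) 1 : Vertex k (ℓ + 1) → ℝ) (.sink i)) = 0 := by
      refine Finset.sum_eq_zero fun i _ => ?_
      rw [Pi.single_eq_of_ne (by cases a <;> nofun), Pi.single_eq_of_ne (by cases a <;> nofun),
        sub_zero, mul_zero]
    rw [hs, pairing_succ] at hw
    rcases a with _ | a | a
    · rw [Finset.sum_eq_zero fun i _ => hz (.one i) (by nofun),
        Finset.sum_eq_zero fun i _ => hz (.two i) (by nofun), comp_eq] at hw
      simpa using hw
    · rw [hz .zero (by nofun), Finset.sum_eq_zero fun i _ => hz (.two i) (by nofun),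
        Finset.sum_eq_single a (fun b _ hb => hz (.one b) (by simpa using hb)) (by simp),
        comp_eq] at hw
      simpa using hw
    · rw [hz .zero (by nofun), Finset.sum_eq_zero fun i _ => hz (.one i) (by nofun),
        Finset.sum_eq_single a (fun b _ hb => hz (.two b) (by simpa using hb)) (by simp),
        comp_eq] at hw
      simpa using hw
  choose F hF using key
  have hp := pairing_succ_of_isFlow (hF .zero) (fun i => hF (.one i)) (fun j => hF (.two j))
  -- The indicator potential of a joint isolates conservation at that joint, which matches the
  -- boundary values of the copies meeting there.
  have e1 : F .zero = fun i => ∑ j, F (.one i) j := by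
    funext i
    have := (hθ (Pi.single (firstJoint i) 1)).symm.trans (hp _)
    simp [Pi.single_apply, firstJoint_inj, source_ne_firstJoint, sink_ne_firstJoint,
      (firstJoint_ne_secondJoint _ _ _).symm] at this
    linarith
  have e2 : ∀ j, F (.two j) = fun i => F (.one i) j := by
    intro j
    funext i
    have := (hθ (Pi.single (secondJoint i j) 1)).symm.trans (hp _)
    simp [Pi.single_apply, secondJoint_inj, source_ne_secondJoint, sink_ne_secondJoint,
      firstJoint_ne_secondJoint, ite_and] at this
    linarith
  refine ⟨fun i => F (.one i), e1 ▸ hF .zero, fun i => hF _, fun j => e2 j ▸ hF _, ?_⟩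
  exact hθ.unique (isFlow_succ (e1 ▸ hF .zero) (fun i => hF _) fun j => e2 j ▸ hF _)

/-! ### Characters of the group of bit strings -/

theorem sign_comm {k : ℕ} (x y : Bits k) : sign x y = sign y x := by
  simp only [sign, mul_comm]

theorem sign_zero {k : ℕ} (y : Bits k) : sign 0 y = 1 := by
  simp [sign]

theorem sign_mul_self {k : ℕ} (x y : Bits k) : sign x y * sign x y = 1 := by
  rw [sign, ← mul_pow]; simp

theorem sign_ne_zero {k : ℕ} (x y : Bits k) : sign x y ≠ 0 := fun h => by
  simpa [h] using sign_mul_self x y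

/-- The sum factors into one-bit sums; a bit where `x` and `y` differ contributes `1 - 1 = 0`, every
other bit contributes `2`. -/
theorem sum_sign_mul_sign {k : ℕ} (x y : Bits k) :
    ∑ i, sign x i * sign y i = if x = y then (2 : ℝ) ^ k else 0 := by
  have h : ∀ i : Bits k, sign x i * sign y i =
      ∏ a, ((-1 : ℝ) ^ ((x a).val * (i a).val) * (-1) ^ ((y a).val * (i a).val)) := fun i => by
    rw [sign, sign, Finset.prod_mul_distrib, Finset.prod_pow_eq_pow_sum,
      Finset.prod_pow_eq_pow_sum]
  have two : ∀ p q : ZMod 2,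
      ∑ b : ZMod 2, ((-1 : ℝ) ^ (p.val * b.val) * (-1) ^ (q.val * b.val)) =
        if p = q then 2 else 0 := by
    intro p q
    rw [show (Finset.univ : Finset (ZMod 2)) = {0, 1} from rfl, Finset.sum_pair (by decide)]
    have h0 : (0 : ZMod 2).val = 0 := rfl
    have h1 : (1 : ZMod 2).val = 1 := rfl
    have hc : ∀ r : ZMod 2, r = 0 ∨ r = 1 := by decide
    rcases hc p with rfl | rfl <;> rcases hc q with rfl | rfl <;> norm_num [h0, h1]
  simp only [h]
  rw [← Fintype.prod_sum fun a (b : ZMod 2) =>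
    (-1 : ℝ) ^ ((x a).val * b.val) * (-1) ^ ((y a).val * b.val)]
  simp only [two]
  by_cases hxy : x = y
  · simp [hxy]
  · obtain ⟨a, ha⟩ := Function.ne_iff.mp hxy
    rw [if_neg hxy]
    exact Finset.prod_eq_zero (Finset.mem_univ a) (by simp [ha])

theorem sum_sign {k : ℕ} {z : Bits k} (hz : z ≠ 0) : ∑ i, sign z i = 0 := by
  have := sum_sign_mul_sign z 0
  simpa [sign_zero, hz] using this

/-- Fourier inversion. -/
theorem sum_sign_smul_sum_sign_smul {k : ℕ} {M : Type*} [AddCommGroup M] [Module ℝ M]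
    (p : Bits k → M) (i : Bits k) :
    ∑ z, sign z i • ∑ i', sign z i' • p i' = (2 : ℝ) ^ k • p i := by
  simp only [Finset.smul_sum, smul_smul]
  rw [Finset.sum_comm]
  simp only [← Finset.sum_smul]
  have : ∀ i', ∑ z, sign z i * sign z i' = if i = i' then (2 : ℝ) ^ k else 0 := fun i' => by
    rw [← sum_sign_mul_sign]
    exact Finset.sum_congr rfl fun z _ => by rw [sign_comm z i, sign_comm z i']
  simp [this]

/-! ### The optimal flows -/

/-- The optimal unit flow to the `j`-th sink, by recursion: the average of the `p_ij`. -/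
noncomputable def optFlow {k : ℕ} : (ℓ : ℕ) → Bits k → Edge k ℓ → ℝ
  | 0, j => fun e => if e.2 = j then 1 else 0
  | ℓ + 1, j => ((2 : ℝ) ^ k)⁻¹ • ∑ i, pState (optFlow ℓ) i j

/-! ### Restrictions of the states to the copies, and their boundary values. -/

section states

variable {k ℓ : ℕ} (θ : Bits k → Edge k ℓ → ℝ)

theorem restr_zero_pState (i j : Bits k) : restr .zero (pState θ i j) = θ i := by
  simp [pState, restr_add, restr_prependSym]

theorem restr_one_pState (i j i' : Bits k) :
    restr (.one i') (pState θ i j) = if i' = i then θ j else 0 := by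
  simp [pState, restr_add, restr_prependSym]

theorem restr_two_pState (i j j' : Bits k) :
    restr (.two j') (pState θ i j) = if j' = j then θ i else 0 := by
  simp [pState, restr_add, restr_prependSym]

/-- The signed sum of the flows to the sinks. -/
noncomputable def signedSum (z : Bits k) : Edge k ℓ → ℝ := ∑ i, sign z i • θ i

/-- Together with the next two lemmas: each copy sees a multiple of a single signed sum, for the
character `z` on copies `0` and `(2,j)` and for `x` on copies `(1,i)`. The scalar here vanishes
unless `x = 0`. -/
theorem restr_zero_psiState (z x : Bits k) :
    restr .zero (psiState θ z x) = (∑ j, sign x j) • signedSum θ z := by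
  simp [psiState, restr_sum, restr_smul, restr_zero_pState, signedSum, Finset.sum_smul]

theorem restr_one_psiState (z x i : Bits k) :
    restr (.one i) (psiState θ z x) = sign z i • signedSum θ x := by
  simp [psiState, restr_sum, restr_smul, restr_one_pState, signedSum, Finset.smul_sum,
    smul_comm (sign z i)]

theorem restr_two_psiState (z x j : Bits k) :
    restr (.two j) (psiState θ z x) = sign x j • signedSum θ z := by
  simp [psiState, restr_sum, restr_smul, restr_two_pState, signedSum]

theorem restr_zero_optFlow (j : Bits k) :
    restr .zero (optFlow (ℓ + 1) j) = ((2 : ℝ) ^ k)⁻¹ • signedSum (optFlow ℓ) 0 := by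
  simp [optFlow, restr_sum, restr_smul, restr_zero_pState, signedSum, sign_zero]

theorem restr_one_optFlow (i j : Bits k) :
    restr (.one i) (optFlow (ℓ + 1) j) = ((2 : ℝ) ^ k)⁻¹ • optFlow ℓ j := by
  simp [optFlow, restr_sum, restr_smul, restr_one_pState]

theorem restr_two_optFlow (j j' : Bits k) :
    restr (.two j') (optFlow (ℓ + 1) j) =
      if j' = j then ((2 : ℝ) ^ k)⁻¹ • signedSum (optFlow ℓ) 0 else 0 := by
  simp only [optFlow, restr_smul, restr_sum, restr_two_pState, signedSum, sign_zero, one_smul]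
  split_ifs <;> simp

variable {θ}

theorem isFlow_signedSum (hθ : ∀ i, IsFlow (Pi.single i 1) (θ i)) (z : Bits k) :
    IsFlow (sign z) (signedSum θ z) := by
  have := IsFlow.sum Finset.univ fun i _ => (hθ i).smul (sign z i)
  convert this using 1
  · funext i
    simp [Pi.single_apply]
  · rfl

/-- The boundary matrix is a product of characters, and its column sums vanish because `z` is a
nontrivial character. -/
theorem isFlow_psiState (hθ : ∀ i, IsFlow (Pi.single i 1) (θ i)) {z : Bits k} (hz : z ≠ 0)
    (x : Bits k) : IsFlow 0 (psiState θ z x) := by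
  have := isFlow_succ (θ := psiState θ z x) (g := fun i j => sign z i * sign x j)
    (by
      rw [restr_zero_psiState]
      convert (isFlow_signedSum hθ z).smul (∑ j, sign x j) using 1
      funext i
      simp [← Finset.mul_sum, mul_comm])
    (fun i => by
      rw [restr_one_psiState]
      exact (isFlow_signedSum hθ x).smul (sign z i))
    (fun j => by
      rw [restr_two_psiState]
      convert (isFlow_signedSum hθ z).smul (sign x j) using 1
      funext i
      simp [mul_comm])
  convert this using 1
  funext j
  simp [← Finset.sum_mul, sum_sign hz]

end states

theorem isFlow_optFlow {k : ℕ} : ∀ (ℓ : ℕ) (j : Bits k), IsFlow (Pi.single j 1) (optFlow ℓ j)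
  | 0, j => fun φ => by
    rw [pairing, Fintype.sum_prod_type]
    simp [ends, optFlow, Pi.single_apply]
  | ℓ + 1, j => by
    have ih := isFlow_optFlow (k := k) ℓ
    have h0 := (isFlow_signedSum ih 0).smul ((2 : ℝ) ^ k)⁻¹
    have := isFlow_succ (θ := optFlow (ℓ + 1) j)
      -- The unit of flow is spread evenly over the copies `(1,i)` and collected in copy `(2,j)`.
      (g := fun _ j' => ((2 : ℝ) ^ k)⁻¹ * (Pi.single j 1 : Bits k → ℝ) j')
      (by
        rw [restr_zero_optFlow]
        convert h0 using 1
        funext i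
        simp [sign_zero, Pi.single_apply])
      (fun i => by
        rw [restr_one_optFlow]
        exact (ih j).smul _)
      (fun j' => by
        rw [restr_two_optFlow]
        split_ifs with h
        · convert h0 using 1
          funext i
          simp [sign_zero, h]
        · convert IsFlow.zero using 1
          funext i
          simp [h])
    convert this using 1
    funext j'
    simp

/-! ### Circulations -/

/-- The vectors `|σ⟩|ψ_{z,x}⟩` with `z ≠ 0̄`, as functions on the edges. -/
def circulationVectors (k m : ℕ) : Set (Edge k m → ℝ) :=
  {η | ∃ (ℓ d : ℕ) (h : d + (ℓ + 1) = m) (σ : Fin d → Sym k) (z x : Bits k), z ≠ 0 ∧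
    η = prepend h σ (psiState (optFlow ℓ) z x)}

theorem psiState_mem {k m : ℕ} {z : Bits k} (hz : z ≠ 0) (x : Bits k) :
    psiState (optFlow m) z x ∈ circulationVectors k (m + 1) :=
  ⟨m, 0, by omega, Fin.elim0, z, x, hz, (prepend_zero _ _ _).symm⟩

theorem prependSym_mem {k m : ℕ} (a : Sym k) {η : Edge k m → ℝ} (hη : η ∈ circulationVectors k m) :
    prependSym a η ∈ circulationVectors k (m + 1) := by
  obtain ⟨ℓ, d, h, σ, z, x, hz, rfl⟩ := hη
  refine ⟨ℓ, d + 1, by omega, Fin.cons a σ, z, x, hz, ?_⟩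
  rw [prepend_succ _ h, Fin.cons_zero, Fin.tail_cons]

/-- Either the word is empty and the vector belongs to the top level, or its first letter splits
off. -/
theorem mem_circulationVectors_succ {k m : ℕ} {η : Edge k (m + 1) → ℝ}
    (hη : η ∈ circulationVectors k (m + 1)) :
    (∃ z x, z ≠ 0 ∧ η = psiState (optFlow m) z x) ∨
      ∃ a, ∃ η' ∈ circulationVectors k m, η = prependSym a η' := by
  obtain ⟨ℓ, d, h, σ, z, x, hz, rfl⟩ := hη
  rcases d with _ | d
  · obtain rfl : ℓ = m := by omega
    exact .inl ⟨z, x, hz, prepend_zero _ _ _⟩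
  · refine .inr ⟨σ 0, _, ⟨ℓ, d, by omega, Fin.tail σ, z, x, hz, rfl⟩, prepend_succ _ _ _ _⟩

theorem prependSym_mem_span {k m : ℕ} (a : Sym k) {η : Edge k m → ℝ}
    (hη : η ∈ Submodule.span ℝ (circulationVectors k m)) :
    prependSym a η ∈ Submodule.span ℝ (circulationVectors k (m + 1)) := by
  have : Submodule.span ℝ (circulationVectors k m) ≤
      (Submodule.span ℝ (circulationVectors k (m + 1))).comap (prependSymₗ a) :=
    Submodule.span_le.mpr fun x hx => Submodule.subset_span (prependSym_mem a hx)
  exact this hη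

theorem isFlow_prependSym {k m : ℕ} (a : Sym k) {η : Edge k m → ℝ} (hη : IsFlow 0 η) :
    IsFlow 0 (prependSym a η) := by
  have h : ∀ b, IsFlow 0 (restr b (prependSym a η)) := fun b => by
    rw [restr_prependSym]
    split_ifs
    exacts [hη, IsFlow.zero]
  have := isFlow_succ (θ := prependSym a η) (g := 0)
    (by convert h .zero using 1; funext i; simp) (fun i => h _) (fun j => h _)
  convert this using 1
  funext i
  simp

theorem isFlow_of_mem_circulationVectors {k : ℕ} : ∀ {m : ℕ} {η : Edge k m → ℝ},
    η ∈ circulationVectors k m → IsFlow 0 η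
  | 0, _, ⟨_, _, h, _⟩ => by omega
  | m + 1, η, hη => by
    rcases mem_circulationVectors_succ hη with ⟨z, x, hz, rfl⟩ | ⟨a, η', hη', rfl⟩
    · exact isFlow_psiState (isFlow_optFlow m) hz x
    · exact isFlow_prependSym a (isFlow_of_mem_circulationVectors hη')

theorem isFlow_sum_smul_optFlow {k ℓ : ℕ} (f : Bits k → ℝ) :
    IsFlow f (∑ i, f i • optFlow ℓ i) := by
  have := IsFlow.sum Finset.univ fun i _ => (isFlow_optFlow (k := k) ℓ i).smul (f i)
  convert this using 1
  funext i
  simp [Pi.single_apply]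

/-- Fourier inversion in both indices expresses the sum through the states `psiState`, with the
transform of `g` as coefficients; `hg` kills the coefficients with `z = 0`, for which no basis
vector is available. -/
theorem sum_smul_pState_mem_span {k m : ℕ} {g : Bits k → Bits k → ℝ} (hg : ∀ j, ∑ i, g i j = 0) :
    ∑ i, ∑ j, g i j • pState (optFlow m) i j ∈
      Submodule.span ℝ (circulationVectors k (m + 1)) := by
  have hp : ∀ i j : Bits k, ∑ z, ∑ x, (sign z i * sign x j) • psiState (optFlow m) z x =
      ((2 : ℝ) ^ k * (2 : ℝ) ^ k) • pState (optFlow m) i j := fun i j => by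
    have h1 : ∀ z, ∑ x, (sign z i * sign x j) • psiState (optFlow m) z x =
        (2 : ℝ) ^ k • sign z i • ∑ i, sign z i • pState (optFlow m) i j := fun z => by
      simp only [mul_smul, ← Finset.smul_sum, psiState]
      rw [sum_sign_smul_sum_sign_smul fun j => ∑ i, sign z i • pState (optFlow m) i j, smul_comm]
    simp only [h1, ← Finset.smul_sum]
    rw [sum_sign_smul_sum_sign_smul fun i => pState (optFlow m) i j, mul_smul]
  have h : ((2 : ℝ) ^ k * (2 : ℝ) ^ k) • ∑ i, ∑ j, g i j • pState (optFlow m) i j =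
      ∑ z, ∑ x, (∑ i, ∑ j, g i j * (sign z i * sign x j)) • psiState (optFlow m) z x := by
    have h1 : ∀ i j, ((2 : ℝ) ^ k * (2 : ℝ) ^ k) • g i j • pState (optFlow m) i j =
        ∑ z, ∑ x, (g i j * (sign z i * sign x j)) • psiState (optFlow m) z x := fun i j => by
      rw [smul_comm, ← hp]
      simp only [Finset.smul_sum, mul_smul]
    simp only [Finset.smul_sum, Finset.sum_smul, h1]
    refine (Finset.sum_congr rfl fun i _ => Finset.sum_comm).trans ?_
    rw [Finset.sum_comm]
    refine Finset.sum_congr rfl fun z _ => ?_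
    refine (Finset.sum_congr rfl fun i _ => Finset.sum_comm).trans ?_
    rw [Finset.sum_comm]
  rw [← Submodule.smul_mem_iff _ (show (2 : ℝ) ^ k * (2 : ℝ) ^ k ≠ 0 by positivity), h]
  refine Submodule.sum_mem _ fun z _ => Submodule.sum_mem _ fun x _ => ?_
  by_cases hz : z = 0
  · rw [Finset.sum_comm]
    simp [hz, sign_zero, ← Finset.sum_mul, hg]
  · exact Submodule.smul_mem _ _ (Submodule.subset_span (psiState_mem hz x))

/-- Every circulation is a combination of the vectors `|σ⟩|ψ_{z,x}⟩`. -/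
theorem mem_span_of_isFlow_zero {k : ℕ} : ∀ {m : ℕ} {θ : Edge k m → ℝ}, IsFlow 0 θ →
    θ ∈ Submodule.span ℝ (circulationVectors k m)
  | 0, θ, hθ => by
    classical
    -- In the star each sink meets one edge only, so there are no nonzero circulations.
    have : θ = 0 := by
      funext e
      have h := hθ (Pi.single (.sink e.2) 1)
      rw [pairing, Fintype.sum_prod_type] at h
      simp [ends, Pi.single_apply] at h
      rwa [Subsingleton.elim default e.1] at h
    rw [this]
    exact Submodule.zero_mem _
  | m + 1, θ, hθ => by
    obtain ⟨g, h0, h1, h2, hg⟩ := hθ.restr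
    -- Subtracting the combination of optimal flows with the same boundary values leaves a
    -- circulation on the copy, to which the induction hypothesis applies.
    have key : ∀ {a f}, IsFlow f (restr a θ) →
        prependSymₗ a (restr a θ - ∑ i, f i • optFlow m i) ∈
          Submodule.span ℝ (circulationVectors k (m + 1)) := fun {a f} h =>
      prependSym_mem_span a (mem_span_of_isFlow_zero (by
        simpa using h.sub (isFlow_sum_smul_optFlow (ℓ := m) f)))
    have hθ' : θ = (prependSymₗ .zero (restr .zero θ - ∑ i, (∑ j, g i j) • optFlow m i) +
        ∑ i, prependSymₗ (.one i) (restr (.one i) θ - ∑ j, g i j • optFlow m j) +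
        ∑ j, prependSymₗ (.two j) (restr (.two j) θ - ∑ i, g i j • optFlow m i)) +
        ∑ i, ∑ j, g i j • pState (optFlow m) i j := by
      refine ext_restr fun a => ?_
      have e : ∀ (b : Sym k) (ψ : Edge k m → ℝ), prependSymₗ b ψ = prependSym b ψ :=
        fun _ _ => rfl
      rcases a with _ | a | a <;>
        simp [restr_add, restr_sum, restr_smul, e, restr_prependSym, restr_zero_pState,
          restr_one_pState, restr_two_pState, Finset.sum_smul]
    rw [hθ']
    refine Submodule.add_mem _ (Submodule.add_mem _ (Submodule.add_mem _ (key h0) ?_) ?_)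
      (sum_smul_pState_mem_span fun j => (congrFun hg j).symm)
    · exact Submodule.sum_mem _ fun i _ => key (h1 i)
    · exact Submodule.sum_mem _ fun j _ => key (h2 j)

open scoped Matrix

/-! ### Orthogonality -/

theorem dotProduct_succ {k ℓ : ℕ} (θ η : Edge k (ℓ + 1) → ℝ) :
    θ ⬝ᵥ η = restr .zero θ ⬝ᵥ restr .zero η + (∑ i, restr (.one i) θ ⬝ᵥ restr (.one i) η +
      ∑ j, restr (.two j) θ ⬝ᵥ restr (.two j) η) := by
  rw [dotProduct, sum_edge, sum_sym]
  rfl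

theorem dotProduct_prependSym {k ℓ : ℕ} (θ : Edge k (ℓ + 1) → ℝ) (a : Sym k) (η : Edge k ℓ → ℝ) :
    θ ⬝ᵥ prependSym a η = restr a θ ⬝ᵥ η := by
  rw [dotProduct_succ]
  rcases a with _ | a | a <;> simp [restr_prependSym, apply_ite, dotProduct_zero]

/-- The shape `a I + b J` is preserved by the recursion: copy `0` adds a constant, the copies
`(1,i)` add multiples of the previous Gram matrix, and the copies `(2,j)` contribute on the diagonal
only. -/
theorem exists_optFlow_dotProduct (k : ℕ) : ∀ ℓ : ℕ, ∃ a b : ℝ, ∀ i j : Bits k,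
    optFlow ℓ i ⬝ᵥ optFlow ℓ j = (if i = j then a else 0) + b
  | 0 => ⟨1, 0, fun i j => by
      rw [dotProduct, Fintype.sum_prod_type]
      simp [optFlow, eq_comm]⟩
  | ℓ + 1 => by
    obtain ⟨a, b, hab⟩ := exists_optFlow_dotProduct k ℓ
    set s := signedSum (optFlow (k := k) ℓ) 0 ⬝ᵥ signedSum (optFlow ℓ) 0
    set c := ((2 : ℝ) ^ k)⁻¹
    refine ⟨∑ _i : Bits k, c * (c * a) + c * (c * s), ∑ _i : Bits k, c * (c * b) + c * (c * s),
      fun i j => ?_⟩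
    simp only [dotProduct_succ, restr_zero_optFlow, restr_one_optFlow, restr_two_optFlow,
      smul_dotProduct, dotProduct_smul, smul_eq_mul, hab]
    have h2 : ∑ j', (if j' = i then c • signedSum (optFlow (k := k) ℓ) 0 else 0) ⬝ᵥ
        (if j' = j then c • signedSum (optFlow ℓ) 0 else 0) =
          if i = j then c * (c * s) else 0 := by
      rw [Finset.sum_eq_single i (fun j' _ h => by rw [if_neg h, zero_dotProduct]) (by simp),
        if_pos rfl]
      split_ifs
      · simp [smul_dotProduct, dotProduct_smul, s]
      · simp
    rw [h2]
    split_ifs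
    · simp only [mul_add, Finset.sum_add_distrib]; ring
    · simp only [zero_add]; ring

/-- The `a` part vanishes by orthogonality of characters, the `b` part because at least one of `z`,
`z'` is nontrivial and sums to zero. -/
theorem signedSum_dotProduct {k ℓ : ℕ} {z z' : Bits k} (h : z ≠ z') :
    signedSum (optFlow ℓ) z ⬝ᵥ signedSum (optFlow ℓ) z' = 0 := by
  obtain ⟨a, b, hab⟩ := exists_optFlow_dotProduct k ℓ
  have h1 : signedSum (optFlow ℓ) z ⬝ᵥ signedSum (optFlow ℓ) z' =
      (∑ i, sign z i * sign z' i) * a + (∑ i, sign z i) * (∑ j, sign z' j) * b := by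
    simp only [signedSum, sum_dotProduct, dotProduct_sum, smul_dotProduct, dotProduct_smul, hab,
      smul_eq_mul, mul_add, Finset.sum_add_distrib, mul_ite, mul_zero, Finset.sum_ite_eq',
      Finset.mem_univ, if_true, Finset.sum_mul, Finset.mul_sum]
    congr 1
    · exact Finset.sum_congr rfl fun i _ => by ring
    · exact Finset.sum_congr rfl fun i _ => Finset.sum_congr rfl fun j _ => by ring
  rw [h1, sum_sign_mul_sign, if_neg h]
  by_cases hz : z = 0
  · rw [sum_sign (z := z') (fun h' => h (hz.trans h'.symm))]; simp
  · rw [sum_sign hz]; simp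

/-- If `z ≠ z'`, the signed sums are orthogonal on copies `0` and `(2,j)`, and the coefficients on
copies `(1,i)` cancel in total. If `z = z'` and `x ≠ x'`, the copies `(1,i)` vanish one by one, the
coefficients on copies `(2,j)` cancel, and on copy `0` one of the two character sums is zero. -/
theorem psiState_dotProduct {k ℓ : ℕ} {z x z' x' : Bits k} (h : ¬(z = z' ∧ x = x')) :
    psiState (optFlow ℓ) z x ⬝ᵥ psiState (optFlow ℓ) z' x' = 0 := by
  simp only [dotProduct_succ, restr_zero_psiState, restr_one_psiState, restr_two_psiState,
      smul_dotProduct, dotProduct_smul, smul_eq_mul, ← mul_assoc, ← Finset.sum_mul]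
  by_cases hz : z = z'
  · have hx : x ≠ x' := fun hx => h ⟨hz, hx⟩
    have h0 : (∑ j, sign x' j) * (∑ j, sign x j) = 0 := by
      by_cases hx0 : x = 0
      · rw [sum_sign (z := x') (fun h' => hx (hx0.trans h'.symm)), zero_mul]
      · rw [sum_sign hx0, mul_zero]
    simp only [mul_comm (sign x' _), mul_comm (∑ j, sign x' j)] at h0 ⊢
    rw [h0, signedSum_dotProduct hx, sum_sign_mul_sign x x', if_neg hx]
    simp
  · simp only [mul_comm (sign z' _)]
    rw [signedSum_dotProduct hz, sum_sign_mul_sign z z', if_neg hz]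
    simp

/-- Against a top-level state, copies `0` and `(2,j)` compare the trivial character with `z ≠ 0`,
while copies `(1,i)` contribute equal amounts weighted by `sign z i`. Against a vector inside one
copy, `ih` applies because the restriction is a combination of optimal flows. -/
theorem optFlow_succ_dotProduct_of_mem {k ℓ : ℕ} (j : Bits k) {η : Edge k (ℓ + 1) → ℝ}
    (hη : η ∈ circulationVectors k (ℓ + 1))
    (ih : ∀ i, ∀ η' ∈ circulationVectors k ℓ, optFlow ℓ i ⬝ᵥ η' = 0) :
    optFlow (ℓ + 1) j ⬝ᵥ η = 0 := by
  rcases mem_circulationVectors_succ hη with ⟨z, x, hz, rfl⟩ | ⟨a, η', hη', rfl⟩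
  · have h0 := signedSum_dotProduct (ℓ := ℓ) hz.symm
    simp only [dotProduct_succ, restr_zero_psiState, restr_one_psiState, restr_two_psiState,
      restr_zero_optFlow, restr_one_optFlow, restr_two_optFlow,
      smul_dotProduct, dotProduct_smul, smul_eq_mul, h0, mul_zero, ← Finset.sum_mul, sum_sign hz]
    rw [zero_mul, zero_add, zero_add]
    refine Finset.sum_eq_zero fun i _ => ?_
    split_ifs
    · rw [smul_dotProduct, h0, smul_zero, mul_zero]
    · rw [zero_dotProduct, mul_zero]
  · rw [dotProduct_prependSym]
    have h0 : signedSum (optFlow ℓ) 0 ⬝ᵥ η' = 0 := by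
      rw [signedSum, sum_dotProduct]
      exact Finset.sum_eq_zero fun i _ => by rw [smul_dotProduct, ih i η' hη', smul_zero]
    rcases a with _ | a | a
    · rw [restr_zero_optFlow, smul_dotProduct, h0, smul_zero]
    · rw [restr_one_optFlow, smul_dotProduct, ih j η' hη', smul_zero]
    · rw [restr_two_optFlow]
      split_ifs
      · rw [smul_dotProduct, h0, smul_zero]
      · rw [zero_dotProduct]

theorem optFlow_dotProduct_of_mem {k : ℕ} : ∀ {m : ℕ} (j : Bits k) {η : Edge k m → ℝ},
    η ∈ circulationVectors k m → optFlow m j ⬝ᵥ η = 0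
  | 0, _, _, ⟨_, _, h, _⟩ => by omega
  | _ + 1, j, _, hη =>
    optFlow_succ_dotProduct_of_mem j hη fun i _ hη' => optFlow_dotProduct_of_mem i hη'

theorem psiState_dotProduct_prependSym {k m : ℕ} (z x : Bits k) (a : Sym k) {η : Edge k m → ℝ}
    (hη : η ∈ circulationVectors k m) : psiState (optFlow m) z x ⬝ᵥ prependSym a η = 0 := by
  have h0 : ∀ z, signedSum (optFlow m) z ⬝ᵥ η = 0 := fun z => by
    rw [signedSum, sum_dotProduct]
    exact Finset.sum_eq_zero fun i _ => by
      rw [smul_dotProduct, optFlow_dotProduct_of_mem i hη, smul_zero]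
  rw [dotProduct_prependSym]
  rcases a with _ | a | a
  · rw [restr_zero_psiState, smul_dotProduct, h0, smul_zero]
  · rw [restr_one_psiState, smul_dotProduct, h0, smul_zero]
  · rw [restr_two_psiState, smul_dotProduct, h0, smul_zero]

/-- The words are compared letter by letter: different first letters give disjoint supports, equal
ones are stripped, and once a word is exhausted the vectors either both sit at the top level or one
lies inside a copy. -/
theorem prepend_psiState_dotProduct {k : ℕ} : ∀ {m ℓ d ℓ' d' : ℕ} (h : d + (ℓ + 1) = m)
    (h' : d' + (ℓ' + 1) = m) (σ : Fin d → Sym k) (σ' : Fin d' → Sym k) (z x z' x' : Bits k)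
    (hz : z ≠ 0) (hz' : z' ≠ 0),
    BasisIndex.circ ℓ d h σ z x hz ≠ BasisIndex.circ ℓ' d' h' σ' z' x' hz' →
    prepend h σ (psiState (optFlow ℓ) z x) ⬝ᵥ prepend h' σ' (psiState (optFlow ℓ') z' x') = 0 := by
  intro m
  induction m with
  | zero => intro _ _ _ _ h; omega
  | succ m ih =>
    intro ℓ d ℓ' d' h h' σ σ' z x z' x' hz hz' hne
    rcases d with _ | d <;> rcases d' with _ | d'
    · obtain rfl : ℓ = m := by omega
      obtain rfl : ℓ' = ℓ := by omega
      rw [prepend_zero, prepend_zero]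
      refine psiState_dotProduct fun hzx => hne ?_
      obtain ⟨rfl, rfl⟩ := hzx
      rw [Subsingleton.elim σ σ']
    · obtain rfl : ℓ = m := by omega
      rw [prepend_zero, prepend_succ h' (by omega)]
      exact psiState_dotProduct_prependSym _ _ _ ⟨_, _, _, _, _, _, hz', rfl⟩
    · obtain rfl : ℓ' = m := by omega
      rw [prepend_zero, prepend_succ h (by omega), dotProduct_comm]
      exact psiState_dotProduct_prependSym _ _ _ ⟨_, _, _, _, _, _, hz, rfl⟩
    · have h1 : d + (ℓ + 1) = m := by omega
      have h1' : d' + (ℓ' + 1) = m := by omega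
      rw [prepend_succ h h1, prepend_succ h' h1', dotProduct_prependSym, restr_prependSym]
      split_ifs with hσ
      · refine ih h1 h1' _ _ z x z' x' hz hz' fun heq => hne ?_
        injection heq with e1 e2 e3 e4 e5
        subst e1 e2 e4 e5
        have : σ = σ' := by
          rw [← Fin.cons_self_tail σ, ← Fin.cons_self_tail σ', hσ, eq_of_heq e3]
        rw [this]
      · exact zero_dotProduct _

theorem optFlow_dotProduct_of_isFlow_zero {k m : ℕ} (j : Bits k) {η : Edge k m → ℝ}
    (hη : IsFlow 0 η) : optFlow m j ⬝ᵥ η = 0 := by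
  refine Submodule.span_induction (p := fun η _ => optFlow m j ⬝ᵥ η = 0)
    (fun η h => optFlow_dotProduct_of_mem j h) (dotProduct_zero _) (fun a b _ _ ha hb => ?_)
    (fun c a _ ha => ?_) (mem_span_of_isFlow_zero hη)
  · rw [dotProduct_add, ha, hb, add_zero]
  · rw [dotProduct_smul, ha, smul_zero]

theorem ne_zero_of_mem_circulationVectors {k : ℕ} : ∀ {m : ℕ} {η : Edge k m → ℝ},
    η ∈ circulationVectors k m → η ≠ 0
  | 0, _, ⟨_, _, h, _⟩ => by omega
  | m + 1, η, hη => by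
    rcases mem_circulationVectors_succ hη with ⟨z, x, hz, rfl⟩ | ⟨a, η', hη', rfl⟩ <;> intro h
    -- A copy `(2,j)` is used because its scalar is a sign; on copy `0` the scalar may vanish. The
    -- signed sum is nonzero since it delivers `±1` at each sink.
    · have h1 := restr_two_psiState (optFlow m) z x 0
      rw [h] at h1
      have h2 : signedSum (optFlow m) z = 0 :=
        ((smul_eq_zero.mp h1.symm).resolve_left (sign_ne_zero _ _))
      have h3 := isFlow_signedSum (isFlow_optFlow (k := k) m) z
      rw [h2] at h3
      exact sign_ne_zero z 0 (congrFun (h3.unique IsFlow.zero) 0)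
    · have h1 := restr_prependSym a a η'
      rw [h, if_pos rfl] at h1
      exact ne_zero_of_mem_circulationVectors hη' h1.symm

/-! ### Optimal flows -/

/-- Pythagoras: two unit flows differ by a circulation, which is orthogonal to `optFlow`, so the
energy exceeds that of `optFlow` by the squared distance to it. -/
theorem isOptimalUnitFlow_iff {k ℓ : ℕ} {V : Type*} (v : Bits k ≃ V) (u : V) (j : Bits k)
    (θ : Edge k ℓ → ℝ) : (net v ℓ u j).IsOptimalUnitFlow θ ↔ θ = optFlow ℓ j := by
  have key : ∀ η : Edge k ℓ → ℝ, IsFlow (Pi.single j 1) η →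
      ∑ e, η e ^ 2 = ∑ e, optFlow ℓ j e ^ 2 + ∑ e, (η e - optFlow ℓ j e) ^ 2 := by
    intro η hη
    have h : optFlow ℓ j ⬝ᵥ (η - optFlow ℓ j) = 0 :=
      optFlow_dotProduct_of_isFlow_zero j (by simpa using hη.sub (isFlow_optFlow ℓ j))
    rw [← add_zero (_ + _), ← mul_zero 2, ← h, dotProduct, Finset.mul_sum,
      ← Finset.sum_add_distrib, ← Finset.sum_add_distrib]
    exact Finset.sum_congr rfl fun e _ => by simp only [Pi.sub_apply]; ring
  simp only [SwitchingNetwork.IsOptimalUnitFlow, isUnitFlow_iff]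
  constructor
  · rintro ⟨h1, h2⟩
    have h3 := h2 _ (isFlow_optFlow ℓ j)
    rw [key θ h1] at h3
    have h4 : ∑ e, (θ e - optFlow ℓ j e) ^ 2 = 0 :=
      le_antisymm (by linarith) (Finset.sum_nonneg fun _ _ => sq_nonneg _)
    rw [Finset.sum_eq_zero_iff_of_nonneg fun _ _ => sq_nonneg _] at h4
    funext e
    have := h4 e (Finset.mem_univ e)
    exact sub_eq_zero.mp (pow_eq_zero_iff two_ne_zero |>.mp this)
  · rintro rfl
    refine ⟨isFlow_optFlow ℓ j, fun η hη => ?_⟩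
    rw [key η hη]
    exact le_add_of_nonneg_right (Finset.sum_nonneg fun _ _ => sq_nonneg _)

/-! ### The orthogonal complement of `B` -/

section space

variable {𝕜 V E Q : Type*} [RCLike 𝕜] [Fintype E]

theorem mem_span_orthogonal {H : Type*} [NormedAddCommGroup H] [InnerProductSpace 𝕜 H] (s : Set H)
    (x : H) : x ∈ (Submodule.span 𝕜 s)ᗮ ↔ ∀ b ∈ s, inner 𝕜 b x = 0 := by
  rw [Submodule.mem_orthogonal]
  refine ⟨fun h b hb => h b (Submodule.subset_span hb), fun h b hb => ?_⟩
  induction hb using Submodule.span_induction with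
  | mem b hb => exact h b hb
  | zero => exact inner_zero_left _
  | add a b _ _ ha hb => rw [inner_add_left, ha, hb, add_zero]
  | smul c a _ ha => rw [inner_smul_left, ha, mul_zero]

theorem inner_ket_left (a : Label E) (x : Space 𝕜 E) : inner 𝕜 (ket 𝕜 a) x = x a := by
  simp [ket, EuclideanSpace.inner_single_left]

open Classical in
theorem ket_apply (a b : Label E) : ket 𝕜 b a = if a = b then 1 else 0 := by
  simp only [ket, PiLp.single_apply]

theorem ket_apply_self (a : Label E) : ket 𝕜 a a = 1 := by
  simp [ket]

theorem ket_apply_of_ne {a b : Label E} (h : a ≠ b) : ket 𝕜 b a = 0 := by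
  simp [ket, h]

open Classical in
theorem mem_spaceB_orthogonal (N : SwitchingNetwork V E Q) (x : Space 𝕜 E) :
    x ∈ (N.spaceB 𝕜)ᗮ ↔ (∀ w, ((∑ e with N.tail e = w, x (.right e)) +
        ∑ e with N.head e = w, x (.left e)) + (if w = N.source then x .leftSrc else 0) +
        (if w = N.sink then x .rightSnk else 0) = 0) ∧
      (∀ e, x (.right e) + x (.left e) = 0) ∧ x .leftSrc + x .rightSnk = 0 := by
  rw [SwitchingNetwork.spaceB, ← Submodule.inf_orthogonal, ← Submodule.inf_orthogonal,
    Submodule.mem_inf, Submodule.mem_inf, mem_span_orthogonal, mem_span_orthogonal,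
    mem_span_orthogonal, Set.forall_mem_range, Set.forall_mem_range, and_assoc]
  have hi : ∀ (p : Prop) (a : Label E),
      inner 𝕜 (if p then ket 𝕜 a else 0) x = if p then x a else 0 := fun p a => by
    split_ifs
    exacts [inner_ket_left a x, inner_zero_left x]
  simp [SwitchingNetwork.star, inner_add_left, sum_inner, inner_ket_left, hi]

theorem edgeState_right (θ : E → ℝ) (e : E) : edgeState 𝕜 θ (.right e) = θ e := by
  classical
  simp [edgeState, ket_apply, Algebra.smul_def]

theorem edgeState_left (θ : E → ℝ) (e : E) : edgeState 𝕜 θ (.left e) = -θ e := by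
  classical
  simp [edgeState, ket_apply, Algebra.smul_def]

theorem edgeState_src (θ : E → ℝ) : edgeState 𝕜 θ .src = 0 := by
  simp [edgeState, ket]

theorem edgeState_snk (θ : E → ℝ) : edgeState 𝕜 θ .snk = 0 := by
  simp [edgeState, ket]

theorem edgeState_leftSrc (θ : E → ℝ) : edgeState 𝕜 θ .leftSrc = 0 := by
  simp [edgeState, ket]

theorem edgeState_rightSnk (θ : E → ℝ) : edgeState 𝕜 θ .rightSnk = 0 := by
  simp [edgeState, ket]

theorem edgeState_zero : edgeState 𝕜 (0 : E → ℝ) = 0 := by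
  simp [edgeState]

theorem edgeState_add (θ η : E → ℝ) : edgeState 𝕜 (θ + η) = edgeState 𝕜 θ + edgeState 𝕜 η := by
  simp [edgeState, add_smul, Finset.sum_add_distrib]

theorem edgeState_smul (c : ℝ) (θ : E → ℝ) :
    edgeState 𝕜 (c • θ) = (c : 𝕜) • edgeState 𝕜 θ := by
  simp [edgeState, mul_smul, Finset.smul_sum]

theorem edgeState_ne_zero {θ : E → ℝ} (h : θ ≠ 0) : edgeState 𝕜 θ ≠ 0 := fun h0 => by
  refine h (funext fun e => ?_)
  have := edgeState_right (𝕜 := 𝕜) θ e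
  rw [h0] at this
  simpa using this.symm

theorem inner_edgeState_left (θ : E → ℝ) (x : Space 𝕜 E) :
    inner 𝕜 (edgeState 𝕜 θ) x = ∑ e, (θ e : 𝕜) * (x (.right e) - x (.left e)) := by
  simp only [edgeState, sum_inner, inner_smul_left, inner_sub_left, inner_ket_left,
    RCLike.conj_ofReal]

theorem inner_edgeState_edgeState (θ η : E → ℝ) :
    inner 𝕜 (edgeState 𝕜 θ) (edgeState 𝕜 η) = ((2 * (θ ⬝ᵥ η) : ℝ) : 𝕜) := by
  rw [inner_edgeState_left, dotProduct, Finset.mul_sum, RCLike.ofReal_sum]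
  refine Finset.sum_congr rfl fun e _ => ?_
  rw [edgeState_right, edgeState_left]
  push_cast
  ring

end space

/-! ### The orthogonal complement of `spaceB` for the recursive network. -/

section net

variable {𝕜 V : Type*} [RCLike 𝕜] {k m : ℕ} (v : Bits k ≃ V) (u : V) (j : Bits k)

open Classical in
theorem isFlow_of_netFlow {c : ℝ} {θ : Edge k m → ℝ}
    (h : ∀ w, (net v m u j).netFlow θ w =
      (if w = .source then c else 0) - (if w = .sink j then c else 0)) :
    IsFlow (c • Pi.single j 1) θ := fun φ => by
  rw [pairing_eq_sum]
  simp only [← netFlow_net v u j, h]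
  simp [mul_sub, Finset.sum_sub_distrib, Pi.single_apply, mul_comm]

open Classical in
theorem netFlow_of_isFlow {c : ℝ} {θ : Edge k m → ℝ} (h : IsFlow (c • Pi.single j 1) θ)
    (w : Vertex k m) : (net v m u j).netFlow θ w =
      (if w = .source then c else 0) - (if w = .sink j then c else 0) := by
  rw [netFlow_net, h, Finset.sum_eq_single j (fun i _ hi => by simp [hi]) (by simp)]
  simp [Pi.single_apply, mul_sub, eq_comm (b := w)]

theorem edgeState_mem_orthogonal {θ : Edge k m → ℝ} (h : IsFlow 0 θ) :
    edgeState 𝕜 θ ∈ ((net v m u j).spaceB 𝕜)ᗮ := by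
  classical
  rw [mem_spaceB_orthogonal]
  refine ⟨fun w => ?_, fun e => ?_, ?_⟩
  · have := netFlow_of_isFlow v u j (c := 0) (by simpa using h) w
    simp only [ite_self, sub_zero, SwitchingNetwork.netFlow] at this
    simp only [edgeState_right, edgeState_left, edgeState_leftSrc, edgeState_rightSnk, ite_self,
      add_zero, Finset.sum_neg_distrib, ← sub_eq_add_neg]
    exact_mod_cast congrArg (RCLike.ofReal (K := 𝕜)) this
  · rw [edgeState_right, edgeState_left, add_neg_cancel]
  · rw [edgeState_leftSrc, edgeState_rightSnk, add_zero]

theorem flowState_optFlow : (net v m u j).flowState 𝕜 (optFlow m j) =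
    edgeState 𝕜 (optFlow m j) - ket 𝕜 .leftSrc + ket 𝕜 .rightSnk := by
  obtain ⟨-, h1, h2⟩ := (isUnitFlow_iff v u j _).mpr (isFlow_optFlow m j)
  rw [SwitchingNetwork.flowState, h1, h2]
  simp
  abel

theorem flowState_mem_orthogonal :
    (net v m u j).flowState 𝕜 (optFlow m j) ∈ ((net v m u j).spaceB 𝕜)ᗮ := by
  classical
  rw [flowState_optFlow, mem_spaceB_orthogonal]
  refine ⟨fun w => ?_, fun e => ?_, ?_⟩
  · have := netFlow_of_isFlow v u j (c := 1) (by simpa using isFlow_optFlow m j) w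
    rw [SwitchingNetwork.netFlow] at this
    have h2 := congrArg (RCLike.ofReal (K := 𝕜)) this
    push_cast at h2
    simp only [PiLp.add_apply, PiLp.sub_apply, edgeState_right, edgeState_left, edgeState_leftSrc,
      edgeState_rightSnk, ket_apply_self, ne_eq, reduceCtorEq, not_false_eq_true, ket_apply_of_ne,
      sub_zero, add_zero, zero_sub, zero_add, Finset.sum_neg_distrib, ← sub_eq_add_neg]
    rw [h2]
    simp only [net]
    split_ifs <;> simp_all
  · simp [edgeState_right, edgeState_left, ket_apply_of_ne]
  · simp [edgeState_leftSrc, edgeState_rightSnk, ket_apply_of_ne, ket_apply_self]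

theorem ket_src_mem_orthogonal : ket 𝕜 .src ∈ ((net v m u j).spaceB 𝕜)ᗮ := by
  simp [mem_spaceB_orthogonal, ket_apply_of_ne]

theorem ket_snk_mem_orthogonal : ket 𝕜 .snk ∈ ((net v m u j).spaceB 𝕜)ᗮ := by
  simp [mem_spaceB_orthogonal, ket_apply_of_ne]

theorem edgeState_mem_span_basisVector {η : Edge k m → ℝ} (hη : IsFlow 0 η) :
    edgeState 𝕜 η ∈ Submodule.span 𝕜 (Set.range (basisVector 𝕜 v m u j optFlow)) := by
  refine Submodule.span_induction (p := fun η _ => edgeState 𝕜 η ∈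
    Submodule.span 𝕜 (Set.range (basisVector 𝕜 v m u j optFlow))) ?_ ?_ ?_ ?_
    (mem_span_of_isFlow_zero hη)
  · rintro η ⟨ℓ, d, h, σ, z, x, hz, rfl⟩
    exact Submodule.subset_span ⟨.circ ℓ d h σ z x hz, rfl⟩
  · rw [edgeState_zero]
    exact Submodule.zero_mem _
  · intro a b _ _ ha hb
    rw [edgeState_add]
    exact Submodule.add_mem _ ha hb
  · intro c a _ ha
    rw [edgeState_smul]
    exact Submodule.smul_mem _ _ ha

/-- The flow given by a real part of a vector in the orthogonal complement of `B`. -/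
theorem isFlow_of_mem_orthogonal {x : Space 𝕜 (Edge k m)} (hx : x ∈ ((net v m u j).spaceB 𝕜)ᗮ)
    (r : 𝕜 →+ ℝ) :
    IsFlow 0 ((fun e => r (x (.right e))) + r (x .leftSrc) • optFlow m j) := by
  classical
  obtain ⟨h1, h2, h3⟩ := (mem_spaceB_orthogonal _ _).mp hx
  -- The coordinate `leftSrc` enters the star equation at the source with a plus sign, so it is
  -- minus the amount of flow sent.
  have h : IsFlow ((-r (x .leftSrc)) • Pi.single j 1) (fun e => r (x (.right e))) := by
    refine isFlow_of_netFlow v u j fun w => ?_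
    have hw := h1 w
    have hs : (net v m u j).source = .source := rfl
    have ht : (net v m u j).sink = .sink j := rfl
    rw [SwitchingNetwork.netFlow]
    simp only [fun e => eq_neg_of_add_eq_zero_right (h2 e), eq_neg_of_add_eq_zero_right h3,
      hs, ht, Finset.sum_neg_distrib] at hw ⊢
    split_ifs at hw ⊢ <;>
    · have := congrArg r hw
      simp only [map_add, map_sum, map_neg, map_zero] at this
      linarith
  have := h.add ((isFlow_optFlow m j).smul (r (x .leftSrc)))
  simpa using this

/-- Flows are real, so the real and imaginary parts of `x` are treated separately: each becomes a
circulation after cancelling its share of the unit flow, and the multiple `-x .leftSrc` of the flow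
state restores what was cancelled. -/
theorem orthogonal_le_span :
    ((net v m u j).spaceB 𝕜)ᗮ ≤ Submodule.span 𝕜 (Set.range (basisVector 𝕜 v m u j optFlow)) := by
  intro x hx
  obtain ⟨-, h2, h3⟩ := (mem_spaceB_orthogonal _ _).mp hx
  have hre := edgeState_mem_span_basisVector (𝕜 := 𝕜) v u j
    (isFlow_of_mem_orthogonal v u j hx RCLike.re)
  have him := edgeState_mem_span_basisVector (𝕜 := 𝕜) v u j
    (isFlow_of_mem_orthogonal v u j hx RCLike.im)
  have hF : (net v m u j).flowState 𝕜 (optFlow m j) ∈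
      Submodule.span 𝕜 (Set.range (basisVector 𝕜 v m u j optFlow)) :=
    Submodule.subset_span ⟨.flow, rfl⟩
  have hs : ket 𝕜 .src ∈ Submodule.span 𝕜 (Set.range (basisVector 𝕜 v m u j optFlow)) :=
    Submodule.subset_span ⟨.src, rfl⟩
  have ht : ket 𝕜 .snk ∈ Submodule.span 𝕜 (Set.range (basisVector 𝕜 v m u j optFlow)) :=
    Submodule.subset_span ⟨.snk, rfl⟩
  have hsum := Submodule.add_mem _ (Submodule.add_mem _ (Submodule.add_mem _ hre
    (Submodule.smul_mem _ (RCLike.I : 𝕜) him)) (Submodule.smul_mem _ (-x .leftSrc) hF))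
    (Submodule.add_mem _ (Submodule.smul_mem _ (x .src) hs) (Submodule.smul_mem _ (x .snk) ht))
  convert hsum using 1
  have hright : ∀ e, x (.right e) =
      ((RCLike.re (x (.right e)) + RCLike.re (x .leftSrc) * optFlow m j e : ℝ) : 𝕜) +
      RCLike.I * ((RCLike.im (x (.right e)) + RCLike.im (x .leftSrc) * optFlow m j e : ℝ) : 𝕜) -
      x .leftSrc * (optFlow m j e : 𝕜) := fun e => by
    have h4 := RCLike.re_add_im (x (.right e))
    have h5 := RCLike.re_add_im (x .leftSrc)
    push_cast
    linear_combination -h4 - (optFlow m j e : 𝕜) * h5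
  rw [flowState_optFlow]
  ext a
  rcases a with e | e | _ | _ | _ | _
  · simpa [edgeState_right, ket_apply_of_ne, sub_eq_add_neg] using hright e
  · rw [eq_neg_of_add_eq_zero_right (h2 e), hright e]
    simp [edgeState_left, ket_apply_of_ne]
    ring
  · simp [edgeState_src, ket_apply_of_ne, ket_apply_self]
  · simp [edgeState_snk, ket_apply_of_ne, ket_apply_self]
  · simp [edgeState_leftSrc, ket_apply_of_ne, ket_apply_self]
  · rw [eq_neg_of_add_eq_zero_right h3]
    simp [edgeState_rightSnk, ket_apply_of_ne, ket_apply_self]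

theorem inner_flowState_edgeState {η : Edge k m → ℝ} (hη : IsFlow 0 η) :
    inner 𝕜 ((net v m u j).flowState 𝕜 (optFlow m j)) (edgeState 𝕜 η) = 0 := by
  rw [flowState_optFlow, inner_add_left, inner_sub_left, inner_ket_left, inner_ket_left,
    inner_edgeState_edgeState, edgeState_leftSrc, edgeState_rightSnk,
    optFlow_dotProduct_of_isFlow_zero j hη]
  simp

theorem isFlow_circ {ℓ d : ℕ} (h : d + (ℓ + 1) = m) (σ : Fin d → Sym k) {z : Bits k} (hz : z ≠ 0)
    (x : Bits k) : IsFlow 0 (prepend h σ (psiState (optFlow ℓ) z x)) :=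
  isFlow_of_mem_circulationVectors ⟨ℓ, d, h, σ, z, x, hz, rfl⟩

theorem inner_basisVector {p q : BasisIndex k m} (hpq : p ≠ q) :
    inner 𝕜 (basisVector 𝕜 v m u j optFlow p) (basisVector 𝕜 v m u j optFlow q) = 0 := by
  have hsF : inner 𝕜 (ket 𝕜 .src) ((net v m u j).flowState 𝕜 (optFlow m j)) = 0 := by
    simp [inner_ket_left, flowState_optFlow, edgeState_src, ket_apply_of_ne]
  have htF : inner 𝕜 (ket 𝕜 .snk) ((net v m u j).flowState 𝕜 (optFlow m j)) = 0 := by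
    simp [inner_ket_left, flowState_optFlow, edgeState_snk, ket_apply_of_ne]
  rcases p with ⟨ℓ, d, h, σ, z, x, hz⟩ | _ | _ | _ <;>
    rcases q with ⟨ℓ', d', h', σ', z', x', hz'⟩ | _ | _ | _ <;>
    first | exact absurd rfl hpq | simp only [basisVector]
  · rw [inner_edgeState_edgeState, prepend_psiState_dotProduct h h' σ σ' z x z' x' hz hz' hpq]
    simp
  · exact inner_eq_zero_symm.mp (inner_flowState_edgeState v u j (isFlow_circ h σ hz x))
  · exact inner_eq_zero_symm.mp ((inner_ket_left _ _).trans (edgeState_src _))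
  · exact inner_eq_zero_symm.mp ((inner_ket_left _ _).trans (edgeState_snk _))
  · exact inner_flowState_edgeState v u j (isFlow_circ h' σ' hz' x')
  · exact inner_eq_zero_symm.mp hsF
  · exact inner_eq_zero_symm.mp htF
  · exact (inner_ket_left _ _).trans (edgeState_src _)
  · exact hsF
  · exact (inner_ket_left _ _).trans (ket_apply_of_ne nofun)
  · exact (inner_ket_left _ _).trans (edgeState_snk _)
  · exact htF
  · exact (inner_ket_left _ _).trans (ket_apply_of_ne nofun)

theorem basisVector_ne_zero (p : BasisIndex k m) : basisVector 𝕜 v m u j optFlow p ≠ 0 := by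
  rcases p with ⟨ℓ, d, h, σ, z, x, hz⟩ | _ | _ | _
  · exact edgeState_ne_zero (ne_zero_of_mem_circulationVectors ⟨ℓ, d, h, σ, z, x, hz, rfl⟩)
  · intro h0
    have := congrArg (fun x : Space 𝕜 (Edge k m) => x .leftSrc) h0
    simp [basisVector, flowState_optFlow, edgeState_leftSrc, ket_apply_self,
      ket_apply_of_ne] at this
  · intro h0
    have := congrArg (fun x : Space 𝕜 (Edge k m) => x .src) h0
    simp [basisVector, ket_apply_self] at this
  · intro h0
    have := congrArg (fun x : Space 𝕜 (Edge k m) => x .snk) h0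
    simp [basisVector, ket_apply_self] at this

theorem isOrthogonalBasis_basisVector :
    IsOrthogonalBasis (basisVector 𝕜 v m u j optFlow) ((net v m u j).spaceB 𝕜)ᗮ := by
  have ho : ∀ p q, p ≠ q → inner 𝕜 (basisVector 𝕜 v m u j optFlow p)
    (basisVector 𝕜 v m u j optFlow q) = 0 := fun p q hpq => inner_basisVector v u j hpq
  refine ⟨ho, linearIndependent_of_ne_zero_of_inner_eq_zero (basisVector_ne_zero v u j)
    fun p q hpq => ho p q hpq, le_antisymm (Submodule.span_le.mpr ?_) (orthogonal_le_span v u j)⟩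
  rintro _ ⟨⟨ℓ, d, h, σ, z, x, hz⟩ | _ | _ | _, rfl⟩
  · exact edgeState_mem_orthogonal v u j (isFlow_circ h σ hz x)
  · exact flowState_mem_orthogonal v u j
  · exact ket_src_mem_orthogonal v u j
  · exact ket_snk_mem_orthogonal v u j

end net

end SwitchNet

theorem mainTheorem4 (𝕜 : Type*) [RCLike 𝕜] {V : Type*} (k m : ℕ)
    (v : SwitchNet.Bits k ≃ V) (u : V) (j : SwitchNet.Bits k) :
    (∀ (ℓ : ℕ) (i : SwitchNet.Bits k),
      ∃! θ : SwitchNet.Edge k ℓ → ℝ, (SwitchNet.net v ℓ u i).IsOptimalUnitFlow θ) ∧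
    ∀ θ : (ℓ : ℕ) → SwitchNet.Bits k → SwitchNet.Edge k ℓ → ℝ,
      (∀ ℓ i, (SwitchNet.net v ℓ u i).IsOptimalUnitFlow (θ ℓ i)) →
      SwitchNet.IsOrthogonalBasis (SwitchNet.basisVector 𝕜 v m u j θ)
        ((SwitchNet.net v m u j).spaceB 𝕜)ᗮ := by
  refine ⟨fun ℓ i => ?_, fun θ hθ => ?_⟩
  · simp only [SwitchNet.isOptimalUnitFlow_iff]
    exact ⟨_, rfl, fun _ h => h⟩
  -- Uniqueness of the optimal flow reduces an arbitrary family to the recursive one.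
  · obtain rfl : θ = SwitchNet.optFlow :=
      funext fun ℓ => funext fun i => (SwitchNet.isOptimalUnitFlow_iff v u i _).mp (hθ ℓ i)
    exact SwitchNet.isOrthogonalBasis_basisVector v u j
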